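/- Let $\mathcal H$ be a complex Hilbert space and let $\{\psi_n\}_{n\in\mathbb Z}\subset\mathcal H$ be vectors of norm one whose Gram matrix $G=\{\langle\psi_n,\psi_m\rangle\}_{n,m\in\mathbb Z}$ (inner product linear in the first argument) defines a bounded operator on $\ell^2(\mathbb Z)$ and satisfies $\langle\psi_{n+1},\psi_{m+1}\rangle=\langle\psi_n,\psi_m\rangle$ for all $n,m$. Let $\varphi(k)=\sum_{n\in\mathbb Z}\langle\psi_n,\psi_0\rangle e^{ink}$ (convergence in $L^2(\mathbb T)$) be its symbol. Let $\varkappa=\{\varkappa_n\}_{n\in\mathbb Z}$ be independent, identically distributed random variables whose law $\mathbf P_0$ has compact support contained in $(0,\infty)$, and put $\varkappa_{\max}=\sup(\operatorname{supp}\mathbf P_0)$. For $N\ge 0$ let $$\mathcal P^{(N)}_\varkappa=\sum_{n=-N}^{N}\varkappa_n\langle\,\cdot\,,\psi_n\rangle\psi_n ,$$ and let $\nu^{(N)}_{\mathcal P_\varkappa}$ be the measure with a point mass $\frac1{2N+1}$ at each non-zero eigenvalue of $\mathcal P^{(N)}_\varkappa$, counted with multiplicity. The integrated density of states (IDS) measure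 $\nu=\nu_{\mathcal P_\varkappa}$ is the non-random probability measure on $\mathbb R$ to which, almost surely, the measures $\nu^{(N)}_{\mathcal P_\varkappa}$ converge weakly as $N\to\infty$. Assume that $\mathbf P_0$ is absolutely continuous with a density $\rho$ that is bounded by $\rho_{\max}<\infty$ almost everywhere. Then the IDS measure $\nu$ exists, its restriction to $\mathbb R\setminus\{0\}$ is absolutely continuous with respect to Lebesgue measure, and its density satisfies $$\frac{d\nu(\lambda)}{d\lambda}\le\frac{\rho_{\max}\,\varkappa_{\max}}{\lambda}\qquad\text{for almost every }\lambda>0 ,$$ a bound that does not depend on the symbol $\varphi$. If moreover $\varphi\neq 0$ almost everywhere on $\mathbb T$, then $\nu$ is absolutely continuous on the whole of $\mathbb R$. -/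

import Mathlib

open MeasureTheory Filter Topology
open scoped ENNReal BoundedContinuousFunction

noncomputable section

namespace RankOneSum

/-- The space `ℓ²(ℤ)`. -/
abbrev L2Z : Type := lp (fun _ : ℤ => ℂ) 2

/-- The doubly infinite matrix `A` defines a bounded operator on `ℓ²(ℤ)`: there is a bounded
operator `T` with `(T δ_m)(n) = A n m` for all `n`, `m`. -/
def IsBoundedMatrix (A : ℤ → ℤ → ℂ) : Prop :=
  ∃ T : L2Z →L[ℂ] L2Z, ∀ n m : ℤ, T (lp.single 2 m (1 : ℂ)) n = A n m

variable {H : Type*} [NormedAddCommGroup H] [InnerProductSpace ℂ H]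

/-- The entry `⟨ψ_n, ψ_m⟩` of the Gram matrix, for the convention in which the inner product is
linear in its first argument (Mathlib's `inner` is linear in the second one). -/
def gramEntry (ψ : ℤ → H) (n m : ℤ) : ℂ := inner ℂ (ψ m) (ψ n)

/-- The assumptions on the vectors: they have norm one, their Gram matrix is bounded on `ℓ²(ℤ)`
and is invariant under shifts of the indices. -/
structure IsAdmissible (ψ : ℤ → H) : Prop where
  norm_eq_one : ∀ n, ‖ψ n‖ = 1
  bounded : IsBoundedMatrix (gramEntry ψ)
  shift : ∀ n m, gramEntry ψ (n + 1) (m + 1) = gramEntry ψ n m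

/-- The symbol `φ = ∑ₙ ⟨ψ_n, ψ_0⟩ e_n`, a Fourier series converging in `L²` of the circle. The
circle is written as `ℝ / ℤ`, so that `e_n(x) = exp (2 π i n x)`, and carries its normalised
Lebesgue measure. -/
def symbol (ψ : ℤ → H) : Lp ℂ 2 (AddCircle.haarAddCircle (T := (1 : ℝ))) :=
  ∑' n : ℤ, gramEntry ψ n 0 • fourierLp (T := (1 : ℝ)) 2 n

/-- The finite rank operator `∑_{n = -N}^{N} ϰ_n ⟨·, ψ_n⟩ ψ_n`. -/
def truncated (ψ : ℤ → H) (ϰ : ℤ → ℝ) (N : ℕ) : H →L[ℂ] H :=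
  ∑ n ∈ Finset.Icc (-(N : ℤ)) (N : ℤ), (ϰ n : ℂ) • InnerProductSpace.rankOne ℂ (ψ n) (ψ n)

/-- The normalised eigenvalue counting measure of the truncated operator: a point mass
`1 / (2 N + 1)` at each non-zero eigenvalue, counted with multiplicity. (The operator is
self-adjoint, so its eigenvalues are real.) -/
def countingMeasure (ψ : ℤ → H) (ϰ : ℤ → ℝ) (N : ℕ) : Measure ℝ :=
  ((2 * N + 1 : ℕ) : ℝ≥0∞)⁻¹ •
    Measure.sum fun x : {x : ℝ // x ≠ 0} =>
      (Module.finrank ℂ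
        (Module.End.eigenspace (truncated ψ ϰ N : H →ₗ[ℂ] H) ((x : ℝ) : ℂ)) : ℝ≥0∞) •
          Measure.dirac (x : ℝ)

/-- `ν` is the integrated density of states measure: a non-random probability measure which is,
for almost every sequence `ϰ` of independent variables with law `P₀`, the weak limit of the
normalised eigenvalue counting measures. -/
structure IsIDSMeasure (ψ : ℤ → H) (P₀ : Measure ℝ) [IsProbabilityMeasure P₀] (ν : Measure ℝ) :
    Prop where
  isProbabilityMeasure : IsProbabilityMeasure ν
  tendsto : ∀ᵐ ϰ ∂(Measure.infinitePi fun _ : ℤ => P₀), ∀ f : ℝ →ᵇ ℝ,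
    Tendsto (fun N : ℕ => ∫ x, f x ∂(countingMeasure ψ ϰ N)) atTop (𝓝 (∫ x, f x ∂ν))

end RankOneSum

end

/-!
*Existence.* The truncated operator and the Gram matrix of the vectors `√ϰ_n ψ_n` have the same
non-zero eigenvalues. The normalised traces of the powers of this matrix decouple over long blocks
of indices, up to an error that vanishes with the block length, and distinct blocks contribute
independent terms. By the strong law of large numbers every moment of the counting measures
converges almost surely to a constant, and by Weierstrass' theorem so does the integral of every
continuous function.

*Density bound.* Changing a single coupling `ϰ_n` is a rank-one perturbation, under which the
diagonal entry `F` of the resolvent at `ψ_n` becomes `F / (1 + t F) = 1 / (t - w)` with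
`w = -1 / F` in the upper half plane. Its imaginary part is `π` times a Cauchy density in `t`, so
its average against a probability density bounded by `ρ_max` is at most `π ρ_max`. Summing over `n`
shows that the Poisson integrals of `t dν(t)` are at most `π ρ_max ϰ_max`, that is,
`t dν(t) ≤ ρ_max ϰ_max dt`.

*No atom at the origin.* If the symbol `φ` is non-zero almost everywhere, then its modulations
`e_m φ` span a dense subspace of `L²` (Wiener), so `ψ_0` has an approximately biorthogonal vector.
This bounds the diagonal of `(G + ε)⁻¹`, hence the proportion of small eigenvalues.
-/

namespace RankOneSum

section Frame

theorem finrank_eigenspace_comp_comm {K E F : Type*} [Field K] [AddCommGroup E] [Module K E]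
    [AddCommGroup F] [Module K F] (f : E →ₗ[K] F) (g : F →ₗ[K] E) {μ : K} (hμ : μ ≠ 0) :
    Module.finrank K (Module.End.eigenspace (f ∘ₗ g) μ) =
      Module.finrank K (Module.End.eigenspace (g ∘ₗ f) μ) := by
  have hg : ∀ x ∈ Module.End.eigenspace (f ∘ₗ g) μ, g x ∈ Module.End.eigenspace (g ∘ₗ f) μ := by
    intro x hx
    rw [Module.End.mem_eigenspace_iff, LinearMap.comp_apply] at hx ⊢
    rw [hx, map_smul]
  refine LinearEquiv.finrank_eq (LinearEquiv.ofBijective (g.restrict hg) ⟨?_, ?_⟩)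
  · rw [injective_iff_map_eq_zero]
    rintro ⟨x, hx⟩ hgx
    have hgx : g x = 0 := congrArg Subtype.val hgx
    rw [Module.End.mem_eigenspace_iff, LinearMap.comp_apply, hgx, map_zero] at hx
    exact Subtype.ext ((smul_eq_zero.1 hx.symm).resolve_left hμ)
  · rintro ⟨y, hy⟩
    rw [Module.End.mem_eigenspace_iff, LinearMap.comp_apply] at hy
    refine ⟨⟨μ⁻¹ • f y, ?_⟩, Subtype.ext ?_⟩
    · rw [Module.End.mem_eigenspace_iff, LinearMap.comp_apply, map_smul, hy, map_smul, map_smul,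
        smul_comm]
    · change g (μ⁻¹ • f y) = y
      rw [map_smul, hy, inv_smul_smul₀ hμ]

variable {H : Type*} [NormedAddCommGroup H] [InnerProductSpace ℂ H]
variable {ι : Type*} [Fintype ι]

/-- The frame operator `∑ᵢ ⟨·, v_i⟩ v_i` of a finite family of vectors. -/
noncomputable def frameOp (v : ι → H) : H →L[ℂ] H := ∑ i, InnerProductSpace.rankOne ℂ (v i) (v i)

/-- The synthesis operator `u ↦ ∑ᵢ u_i v_i` of a finite family of vectors. -/
noncomputable def synthesis (v : ι → H) : EuclideanSpace ℂ ι →ₗ[ℂ] H :=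
  Fintype.linearCombination ℂ v ∘ₗ (WithLp.linearEquiv 2 ℂ (ι → ℂ)).toLinearMap

/-- The analysis operator `x ↦ (⟨x, v_i⟩)ᵢ` of a finite family of vectors, the formal adjoint of
the synthesis operator. -/
noncomputable def analysis (v : ι → H) : H →ₗ[ℂ] EuclideanSpace ℂ ι :=
  (WithLp.linearEquiv 2 ℂ (ι → ℂ)).symm.toLinearMap ∘ₗ
    LinearMap.pi fun i => (innerSL ℂ (v i)).toLinearMap

theorem synthesis_apply (v : ι → H) (u : EuclideanSpace ℂ ι) :
    synthesis v u = ∑ i, u i • v i := by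
  simp [synthesis, Fintype.linearCombination_apply]

omit [Fintype ι] in
theorem analysis_apply (v : ι → H) (x : H) (i : ι) : analysis v x i = inner ℂ (v i) x := by
  simp [analysis]

theorem inner_synthesis_left (v : ι → H) (u : EuclideanSpace ℂ ι) (x : H) :
    inner ℂ (synthesis v u) x = inner ℂ u (analysis v x) := by
  simp only [synthesis_apply, sum_inner, inner_smul_left, PiLp.inner_apply, analysis_apply,
    RCLike.inner_apply, mul_comm]

theorem synthesis_comp_analysis (v : ι → H) :
    synthesis v ∘ₗ analysis v = (frameOp v : H →ₗ[ℂ] H) := by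
  ext x
  simp [synthesis_apply, analysis_apply, frameOp]

variable [DecidableEq ι]

theorem synthesis_single (v : ι → H) (i : ι) :
    synthesis v (EuclideanSpace.single i 1) = v i := by
  simp [synthesis_apply]

theorem analysis_comp_synthesis (v : ι → H) :
    analysis v ∘ₗ synthesis v = Matrix.toEuclideanLin (Matrix.gram ℂ v) := by
  refine LinearMap.ext fun u => ?_
  ext i
  simp [synthesis_apply, analysis_apply, Matrix.mulVec, dotProduct, mul_comm,
    Matrix.toLpLin_apply]

/-- The eigenvalues of the Gram matrix of a finite family of vectors, with multiplicity. -/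
noncomputable def gramEig (v : ι → H) : ι → ℝ := (Matrix.isHermitian_gram ℂ v).eigenvalues

/-- An orthonormal basis of eigenvectors of the Gram matrix for the eigenvalues `gramEig v`. -/
noncomputable def gramBasis (v : ι → H) : OrthonormalBasis ι ℂ (EuclideanSpace ℂ ι) :=
  (Matrix.isHermitian_gram ℂ v).eigenvectorBasis

theorem gramEig_nonneg (v : ι → H) (k : ι) : 0 ≤ gramEig v k :=
  (Matrix.posSemidef_gram ℂ v).eigenvalues_nonneg k

theorem gramEig_pos {v : ι → H} (hv : LinearIndependent ℂ v) (k : ι) : 0 < gramEig v k :=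
  (Matrix.posDef_gram_of_linearIndependent hv).eigenvalues_pos k

theorem gramEig_congr {H' : Type*} [NormedAddCommGroup H'] [InnerProductSpace ℂ H'] {v : ι → H}
    {w : ι → H'} (h : Matrix.gram ℂ v = Matrix.gram ℂ w) : gramEig v = gramEig w :=
  (Matrix.IsHermitian.eigenvalues_eq_eigenvalues_iff _ _).2 (by rw [h])

theorem analysis_synthesis_gramBasis (v : ι → H) (k : ι) :
    analysis v (synthesis v (gramBasis v k)) = (gramEig v k : ℂ) • gramBasis v k := by
  rw [← LinearMap.comp_apply, analysis_comp_synthesis]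
  exact congrArg (WithLp.toLp 2) ((Matrix.isHermitian_gram ℂ v).mulVec_eigenvectorBasis k)

theorem frameOp_synthesis_gramBasis (v : ι → H) (k : ι) :
    frameOp v (synthesis v (gramBasis v k)) = (gramEig v k : ℂ) • synthesis v (gramBasis v k) := by
  rw [← map_smul, ← analysis_synthesis_gramBasis]
  exact (LinearMap.congr_fun (synthesis_comp_analysis v) _).symm

theorem norm_synthesis_gramBasis_sq (v : ι → H) (k : ι) :
    ‖synthesis v (gramBasis v k)‖ ^ 2 = gramEig v k := by
  rw [← inner_self_eq_norm_sq (𝕜 := ℂ), inner_synthesis_left, analysis_synthesis_gramBasis,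
    inner_smul_right, inner_self_eq_norm_sq_to_K, OrthonormalBasis.norm_eq_one]
  simp

theorem finrank_eigenspace_frameOp (v : ι → H) {x : ℝ} (hx : x ≠ 0) :
    Module.finrank ℂ (Module.End.eigenspace (frameOp v : H →ₗ[ℂ] H) (x : ℂ)) =
      Finset.card {i | gramEig v i = x} := by
  rw [← synthesis_comp_analysis, finrank_eigenspace_comp_comm _ _ (Complex.ofReal_ne_zero.2 hx),
    analysis_comp_synthesis,
    ← (Matrix.isSymmetric_toEuclideanLin_iff.mpr
      (Matrix.isHermitian_gram ℂ v)).card_filter_eigenvalues_eq finrank_euclideanSpace (x : ℂ)]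
  refine Finset.card_equiv (Fintype.equivOfCardEq (Fintype.card_fin _)) fun i => ?_
  rw [Finset.mem_filter, Finset.mem_filter]
  simp [gramEig, Matrix.IsHermitian.eigenvalues, Matrix.IsHermitian.eigenvalues₀]

theorem sum_finrank_eigenspace_frameOp_dirac (v : ι → H) :
    (Measure.sum fun x : {x : ℝ // x ≠ 0} =>
      (Module.finrank ℂ
        (Module.End.eigenspace (frameOp v : H →ₗ[ℂ] H) ((x : ℝ) : ℂ)) : ℝ≥0∞) •
          Measure.dirac (x : ℝ)) =
      ∑ i, if gramEig v i = 0 then 0 else Measure.dirac (gramEig v i) := by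
  ext s hs
  have hx : ∀ x : {x : ℝ // x ≠ 0}, ((Module.finrank ℂ
        (Module.End.eigenspace (frameOp v : H →ₗ[ℂ] H) ((x : ℝ) : ℂ)) : ℝ≥0∞) •
          Measure.dirac (x : ℝ)) s =
      ∑ i, if gramEig v i = x then Measure.dirac (x : ℝ) s else 0 := by
    intro x
    rw [finrank_eigenspace_frameOp v x.2, Measure.smul_apply, smul_eq_mul, ← Finset.sum_filter,
      Finset.sum_const, nsmul_eq_mul]
  rw [Measure.sum_apply _ hs, Measure.finsetSum_apply, tsum_congr hx,
    Summable.tsum_finsetSum fun _ _ => ENNReal.summable]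
  refine Finset.sum_congr rfl fun i _ => ?_
  split_ifs with h0
  · rw [Measure.coe_zero, Pi.zero_apply, ENNReal.tsum_eq_zero]
    exact fun x => if_neg fun h => x.2 (h.symm.trans h0)
  · rw [tsum_eq_single ⟨gramEig v i, h0⟩ fun x hx => if_neg fun h => hx (Subtype.ext h.symm),
      if_pos rfl]

theorem sum_inner_apply_of_eigen (v : ι → H) (R : H →L[ℂ] H) (c : ι → ℂ)
    (hR : ∀ k, R (synthesis v (gramBasis v k)) = c k • synthesis v (gramBasis v k)) :
    ∑ i, inner ℂ (v i) (R (v i)) = ∑ k, c k * gramEig v k := by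
  set S : EuclideanSpace ℂ ι →ₗ[ℂ] EuclideanSpace ℂ ι := analysis v ∘ₗ R.toLinearMap ∘ₗ synthesis v
  have hS : ∀ u, inner ℂ u (S u) = inner ℂ (synthesis v u) (R (synthesis v u)) := fun u =>
    (inner_synthesis_left v u _).symm
  calc ∑ i, inner ℂ (v i) (R (v i)) = S.trace ℂ _ := by
        simp [S.trace_eq_sum_inner (EuclideanSpace.basisFun ι ℂ), hS, synthesis_single]
    _ = ∑ k, c k * gramEig v k := by
        simp_rw [S.trace_eq_sum_inner (gramBasis v), hS, hR, inner_smul_right,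
          inner_self_eq_norm_sq_to_K, ← norm_synthesis_gramBasis_sq]
        simp

theorem sum_inner_resolvent (v : ι → H) {z : ℂ} (hz : z.im ≠ 0) (R : H →L[ℂ] H)
    (hR : ∀ x, R (frameOp v x - z • x) = x) :
    ∑ i, inner ℂ (v i) (R (v i)) = ∑ k, (gramEig v k : ℂ) / (gramEig v k - z) := by
  have hne : ∀ k, (gramEig v k : ℂ) - z ≠ 0 := fun k h => hz (by simpa using congrArg Complex.im h)
  rw [sum_inner_apply_of_eigen v R fun k => ((gramEig v k : ℂ) - z)⁻¹]
  · simp_rw [div_eq_inv_mul]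
  · intro k
    have hk := hR (synthesis v (gramBasis v k))
    rw [frameOp_synthesis_gramBasis, ← sub_smul, map_smul] at hk
    rw [eq_inv_smul_iff₀ (hne k), hk]

theorem exists_gram_add_inverse (v : ι → H) {δ : ℝ} (hδ : 0 < δ) :
    ∃ S : EuclideanSpace ℂ ι →ₗ[ℂ] EuclideanSpace ℂ ι,
      (∀ x, analysis v (synthesis v (S x)) + (δ : ℂ) • S x = x) ∧
      S.trace ℂ _ = ((∑ k, (gramEig v k + δ)⁻¹ : ℝ) : ℂ) := by
  set b := gramBasis v with hb
  set c : ι → ℂ := fun k => ((gramEig v k + δ : ℝ) : ℂ) with hc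
  have hc0 : ∀ k, c k ≠ 0 := fun k =>
    Complex.ofReal_ne_zero.2 (add_pos_of_nonneg_of_pos (gramEig_nonneg v k) hδ).ne'
  set S := b.toBasis.constr ℂ fun k => (c k)⁻¹ • b k with hS
  have hSb : ∀ k, S (b k) = (c k)⁻¹ • b k := fun k => by
    rw [hS, ← b.coe_toBasis, Module.Basis.constr_basis]
  refine ⟨S, fun x => ?_, ?_⟩
  · suffices (analysis v ∘ₗ synthesis v + (δ : ℂ) • LinearMap.id) ∘ₗ S = LinearMap.id from
      LinearMap.congr_fun this x
    refine b.toBasis.ext fun k => ?_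
    simp only [OrthonormalBasis.coe_toBasis, LinearMap.comp_apply, LinearMap.add_apply,
      LinearMap.smul_apply, LinearMap.id_apply, hSb, map_smul]
    rw [hb, analysis_synthesis_gramBasis, ← add_smul, ← Complex.ofReal_add,
      inv_smul_smul₀ (hc0 k)]
  · rw [S.trace_eq_sum_inner b, Complex.ofReal_sum]
    refine Finset.sum_congr rfl fun k _ => ?_
    rw [hSb, inner_smul_right, inner_self_eq_norm_sq_to_K, b.norm_eq_one, hc]
    simp

/-- The `j`-th diagonal entry of `(G + δ)⁻¹` is the maximum of `|x_j|² / ⟨x, (G + δ) x⟩`, attained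
at `x = (G + δ)⁻¹ e_j`. -/
theorem sum_inv_gramEig_add_le (v : ι → H) {δ : ℝ} (hδ : 0 < δ) {C : ι → ℝ} (hC₀ : ∀ j, 0 ≤ C j)
    (hC : ∀ (j : ι) (x : EuclideanSpace ℂ ι),
      ‖x j‖ ^ 2 ≤ C j * (‖synthesis v x‖ ^ 2 + δ * ‖x‖ ^ 2)) :
    ∑ k, (gramEig v k + δ)⁻¹ ≤ ∑ j, C j := by
  obtain ⟨S, hS, htrace⟩ := exists_gram_add_inverse v hδ
  have hdiag : ∀ j, (S (EuclideanSpace.single j 1) j).re ≤ C j := by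
    intro j
    have hSj := hS (EuclideanSpace.single j 1)
    generalize S (EuclideanSpace.single j 1) = u at hSj ⊢
    have hu : ‖synthesis v u‖ ^ 2 + δ * ‖u‖ ^ 2 = (u j).re := by
      have h := congrArg (fun y => (inner ℂ u y).re) hSj
      simp only [inner_add_right, ← inner_synthesis_left, inner_smul_right,
        inner_self_eq_norm_sq_to_K, Complex.add_re, EuclideanSpace.inner_single_right] at h
      simpa [← Complex.ofReal_pow] using h
    rcases le_or_gt (u j).re 0 with hneg | hpos
    · exact hneg.trans (hC₀ j)
    · refine le_of_mul_le_mul_right ?_ hpos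
      calc (u j).re * (u j).re = |(u j).re| ^ 2 := by rw [sq_abs, sq]
        _ ≤ ‖u j‖ ^ 2 := by gcongr; exact Complex.abs_re_le_norm _
        _ ≤ C j * (u j).re := hu ▸ hC j u
  calc ∑ k, (gramEig v k + δ)⁻¹ = (S.trace ℂ _).re := by rw [htrace, Complex.ofReal_re]
    _ = ∑ j, (S (EuclideanSpace.single j 1) j).re := by
        simp [S.trace_eq_sum_inner (EuclideanSpace.basisFun ι ℂ), Complex.re_sum,
          EuclideanSpace.inner_single_left]
    _ ≤ ∑ j, C j := Finset.sum_le_sum fun j _ => hdiag j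

end Frame

section MatrixTrace

open scoped Matrix.Norms.L2Operator

variable {𝕜 ι : Type*} [RCLike 𝕜] [Fintype ι] [DecidableEq ι]

theorem norm_trace_mul_le (A D : Matrix ι ι 𝕜) :
    ‖(A * D).trace‖ ≤ √(Fintype.card ι) * ‖A‖ * √(∑ i, ∑ j, ‖D i j‖ ^ 2) := by
  set col : ι → EuclideanSpace 𝕜 ι := fun i => WithLp.toLp 2 fun j => D j i
  have hentry : ∀ i, ‖(A * D) i i‖ ≤ ‖A‖ * ‖col i‖ := fun i =>
    (PiLp.norm_apply_le (WithLp.toLp 2 (A.mulVec (col i))) i).trans (A.l2_opNorm_mulVec (col i))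
  have hcol : ∑ i, ‖col i‖ ≤ √(Fintype.card ι) * √(∑ i, ‖col i‖ ^ 2) := by
    simpa using Real.sum_mul_le_sqrt_mul_sqrt Finset.univ (fun _ => (1 : ℝ)) fun i => ‖col i‖
  calc ‖(A * D).trace‖ ≤ ∑ i, ‖A‖ * ‖col i‖ :=
        (norm_sum_le _ _).trans (Finset.sum_le_sum fun i _ => hentry i)
    _ = ‖A‖ * ∑ i, ‖col i‖ := (Finset.mul_sum _ _ _).symm
    _ ≤ ‖A‖ * (√(Fintype.card ι) * √(∑ i, ‖col i‖ ^ 2)) := by gcongr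
    _ = √(Fintype.card ι) * ‖A‖ * √(∑ i, ∑ j, ‖D i j‖ ^ 2) := by
        simp_rw [EuclideanSpace.norm_sq_eq, col]
        rw [Finset.sum_comm]
        ring

/-- Telescope `A ^ k - B ^ k = ∑ Aⁱ (A - B) B ^ (k - 1 - i)` and use cyclicity of the trace. -/
theorem norm_trace_pow_sub_pow_le {A B : Matrix ι ι 𝕜} {R : ℝ} (hA : ‖A‖ ≤ R) (hB : ‖B‖ ≤ R)
    (k : ℕ) :
    ‖(A ^ k - B ^ k).trace‖ ≤
      √(Fintype.card ι) * (k * R ^ (k - 1)) * √(∑ i, ∑ j, ‖(A - B) i j‖ ^ 2) := by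
  rcases isEmpty_or_nonempty ι with _ | _
  · simp
  have hR : 0 ≤ R := (norm_nonneg A).trans hA
  have htele : A ^ k - B ^ k =
      ∑ i ∈ Finset.range k, A ^ i * (A - B) * B ^ (k - 1 - i) := by
    have h := Finset.sum_range_sub (fun i => A ^ i * B ^ (k - i)) k
    rw [Nat.sub_self, Nat.sub_zero, pow_zero, pow_zero, mul_one, one_mul] at h
    rw [← h]
    refine Finset.sum_congr rfl fun i hi => ?_
    rw [show k - i = k - 1 - i + 1 by grind, show k - (i + 1) = k - 1 - i by grind,
      pow_succ, pow_succ' B]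
    noncomm_ring
  have hterm : ∀ i ∈ Finset.range k, ‖(A ^ i * (A - B) * B ^ (k - 1 - i)).trace‖ ≤
      √(Fintype.card ι) * R ^ (k - 1) * √(∑ i, ∑ j, ‖(A - B) i j‖ ^ 2) := by
    intro i hi
    have hnorm : ‖B ^ (k - 1 - i) * A ^ i‖ ≤ R ^ (k - 1) := by
      calc ‖B ^ (k - 1 - i) * A ^ i‖ ≤ ‖B‖ ^ (k - 1 - i) * ‖A‖ ^ i :=
            (norm_mul_le _ _).trans (mul_le_mul (norm_pow_le _ _) (norm_pow_le _ _)
              (norm_nonneg _) (by positivity))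
        _ ≤ R ^ (k - 1 - i) * R ^ i := by gcongr
        _ = R ^ (k - 1) := by rw [← pow_add, show k - 1 - i + i = k - 1 by grind]
    rw [Matrix.trace_mul_comm, ← Matrix.mul_assoc]
    exact (norm_trace_mul_le _ _).trans (by gcongr)
  rw [htele, Matrix.trace_sum]
  refine (norm_sum_le_of_le _ hterm).trans_eq ?_
  rw [Finset.sum_const, Finset.card_range, nsmul_eq_mul]
  ring

theorem trace_pow_eq_sum_eigenvalues_pow {A : Matrix ι ι 𝕜} (hA : A.IsHermitian) (k : ℕ) :
    (A ^ k).trace = ∑ i, (hA.eigenvalues i : 𝕜) ^ k := by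
  conv_lhs => rw [hA.spectral_theorem, ← map_pow, Matrix.diagonal_pow]
  rw [Unitary.conjStarAlgAut_apply, Matrix.trace_mul_comm, ← mul_assoc,
    Unitary.coe_star_mul_self, one_mul, Matrix.trace_diagonal]
  rfl

theorem l2_opNorm_eq_norm_eigenvalues {A : Matrix ι ι 𝕜} (hA : A.IsHermitian) :
    ‖A‖ = ‖hA.eigenvalues‖ := by
  conv_lhs => rw [hA.spectral_theorem]
  rw [Unitary.conjStarAlgAut_apply, ← Unitary.coe_star, CStarRing.norm_mul_coe_unitary,
    CStarRing.norm_coe_unitary_mul, Matrix.l2_opNorm_diagonal]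
  simp [Pi.norm_def]

end MatrixTrace

section Bessel

variable {H : Type*} [NormedAddCommGroup H] [InnerProductSpace ℂ H]
variable {H' : Type*} [NormedAddCommGroup H'] [InnerProductSpace ℂ H']
variable {ι κ : Type*}

/-- `R` is a Bessel bound of the family `v`: the synthesis operator `x ↦ ∑ᵢ x_i v_i`, defined on
finitely supported sequences, has square norm at most `R`. -/
def IsBesselBound (v : ι → H) (R : ℝ) : Prop :=
  ∀ (s : Finset ι) (x : ι → ℂ), ‖∑ i ∈ s, x i • v i‖ ^ 2 ≤ R * ∑ i ∈ s, ‖x i‖ ^ 2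

theorem IsBesselBound.comp {v : ι → H} {R : ℝ} (hv : IsBesselBound v R) {f : κ → ι}
    (hf : Function.Injective f) : IsBesselBound (v ∘ f) R := by
  intro s x
  simpa [hf.extend_apply] using hv (s.map ⟨f, hf⟩) (Function.extend f x 0)

theorem IsBesselBound.smul {v : ι → H} {R : ℝ} (hv : IsBesselBound v R) (hR : 0 ≤ R) {c : ι → ℂ}
    {M : ℝ} (hc : ∀ i, ‖c i‖ ^ 2 ≤ M) : IsBesselBound (fun i => c i • v i) (R * M) := by
  intro s x
  simp only [smul_smul]
  refine (hv s fun i => x i * c i).trans ?_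
  rw [mul_assoc]
  refine mul_le_mul_of_nonneg_left ?_ hR
  rw [Finset.mul_sum]
  refine Finset.sum_le_sum fun i _ => ?_
  rw [norm_mul, mul_pow, mul_comm]
  exact mul_le_mul_of_nonneg_right (hc i) (sq_nonneg _)

variable [Fintype ι]

theorem IsBesselBound.norm_synthesis_sq_le {v : ι → H} {R : ℝ} (hv : IsBesselBound v R)
    (u : EuclideanSpace ℂ ι) : ‖synthesis v u‖ ^ 2 ≤ R * ‖u‖ ^ 2 := by
  rw [synthesis_apply, EuclideanSpace.norm_sq_eq]
  exact hv Finset.univ u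

variable [DecidableEq ι]

theorem sum_gramEig_pow (v : ι → H) (k : ℕ) :
    ((∑ i, gramEig v i ^ k : ℝ) : ℂ) = (Matrix.gram ℂ v ^ k).trace := by
  rw [trace_pow_eq_sum_eigenvalues_pow (Matrix.isHermitian_gram ℂ v)]
  push_cast
  rfl

theorem gramEig_le {v : ι → H} {R : ℝ} (hv : IsBesselBound v R) (k : ι) : gramEig v k ≤ R := by
  simpa [norm_synthesis_gramBasis_sq] using hv.norm_synthesis_sq_le (gramBasis v k)

open scoped Matrix.Norms.L2Operator in
theorem l2_opNorm_gram_le {v : ι → H} {R : ℝ} (hR : 0 ≤ R) (hv : IsBesselBound v R) :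
    ‖Matrix.gram ℂ v‖ ≤ R := by
  rw [l2_opNorm_eq_norm_eigenvalues (Matrix.isHermitian_gram ℂ v), pi_norm_le_iff_of_nonneg hR]
  intro k
  exact (Real.norm_of_nonneg (gramEig_nonneg v k)).trans_le (gramEig_le hv k)

theorem abs_sum_gramEig_pow_sub_le {v : ι → H} {w : ι → H'} {R : ℝ} (hR : 0 ≤ R)
    (hv : IsBesselBound v R) (hw : IsBesselBound w R) (k : ℕ) :
    |∑ i, gramEig v i ^ k - ∑ i, gramEig w i ^ k| ≤
      √(Fintype.card ι) * (k * R ^ (k - 1)) *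
        √(∑ i, ∑ j, ‖inner ℂ (v i) (v j) - inner ℂ (w i) (w j)‖ ^ 2) := by
  have h := norm_trace_pow_sub_pow_le (l2_opNorm_gram_le hR hv) (l2_opNorm_gram_le hR hw) k
  rwa [Matrix.trace_sub, ← sum_gramEig_pow, ← sum_gramEig_pow, ← Complex.ofReal_sub,
    Complex.norm_real, Real.norm_eq_abs] at h

variable {β : Type*} [Fintype β] [DecidableEq β]

/-- The family obtained from `v` by moving the blocks `{v (i, b)}ᵢ` into mutually orthogonal copies
of the space. -/
noncomputable def blockFamily (v : ι × β → H) (p : ι × β) : PiLp 2 fun _ : β => H :=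
  PiLp.single 2 p.2 (v p)

omit [Fintype ι] [DecidableEq ι] in
theorem inner_blockFamily (v : ι × β → H) (p q : ι × β) :
    inner ℂ (blockFamily v p) (blockFamily v q) = if p.2 = q.2 then inner ℂ (v p) (v q) else 0 := by
  rw [PiLp.inner_apply, Finset.sum_eq_single p.2 _ (by simp)]
  · by_cases h : p.2 = q.2 <;> simp [blockFamily, h]
  · intro b _ hb
    simp [blockFamily, hb]

omit [Fintype ι] [DecidableEq ι] in
theorem IsBesselBound.blockFamily {v : ι × β → H} {R : ℝ} (hv : IsBesselBound v R) :
    IsBesselBound (blockFamily v) R := by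
  intro s x
  have hblock : ∀ b, (∑ p ∈ s, x p • RankOneSum.blockFamily v p) b =
      ∑ p ∈ s with p.2 = b, x p • v p := by
    intro b
    rw [WithLp.ofLp_sum, Finset.sum_apply, Finset.sum_filter]
    refine Finset.sum_congr rfl fun p _ => ?_
    by_cases h : p.2 = b
    · subst h; simp [RankOneSum.blockFamily]
    · simp [RankOneSum.blockFamily, h, Ne.symm h]
  calc ‖∑ p ∈ s, x p • RankOneSum.blockFamily v p‖ ^ 2
      = ∑ b, ‖∑ p ∈ s with p.2 = b, x p • v p‖ ^ 2 := by
        simp_rw [PiLp.norm_sq_eq_of_L2, hblock]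
    _ ≤ ∑ b, R * ∑ p ∈ s with p.2 = b, ‖x p‖ ^ 2 := Finset.sum_le_sum fun b _ => hv _ x
    _ = R * ∑ p ∈ s, ‖x p‖ ^ 2 := by rw [← Finset.mul_sum, Finset.sum_fiberwise]

theorem sum_gramEig_blockFamily_pow (v : ι × β → H) (k : ℕ) :
    ∑ p, gramEig (blockFamily v) p ^ k = ∑ b, ∑ i, gramEig (fun i => v (i, b)) i ^ k := by
  have hgram : Matrix.gram ℂ (blockFamily v) =
      Matrix.blockDiagonal fun b => Matrix.gram ℂ fun i => v (i, b) := by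
    ext ⟨i, b⟩ ⟨j, c⟩
    rw [Matrix.gram_apply, inner_blockFamily, Matrix.blockDiagonal_apply]
    split_ifs with h
    · obtain rfl : b = c := h
      rfl
    · rfl
  apply Complex.ofReal_injective
  rw [sum_gramEig_pow, hgram, ← Matrix.blockDiagonal_pow, Matrix.trace_blockDiagonal,
    Complex.ofReal_sum]
  exact Finset.sum_congr rfl fun b _ => (sum_gramEig_pow _ k).symm

end Bessel

section Admissible

variable {H : Type*} [NormedAddCommGroup H] [InnerProductSpace ℂ H] {ψ : ℤ → H}

theorem IsBesselBound.sum_norm_inner_sq_le {ι : Type*} {v : ι → H} {R : ℝ}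
    (hv : IsBesselBound v R) (hR : 0 ≤ R) (s : Finset ι) (x : H) :
    ∑ i ∈ s, ‖inner ℂ (v i) x‖ ^ 2 ≤ R * ‖x‖ ^ 2 := by
  set S := ∑ i ∈ s, ‖inner ℂ (v i) x‖ ^ 2
  set y := ∑ i ∈ s, inner ℂ (v i) x • v i with hy
  have hS : 0 ≤ S := Finset.sum_nonneg fun i _ => sq_nonneg _
  have hyx : inner ℂ y x = S := by
    simp only [hy, sum_inner, inner_smul_left, Complex.conj_mul', S, Complex.ofReal_sum,
      Complex.ofReal_pow]
  have hSy : S ≤ ‖y‖ * ‖x‖ := by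
    simpa [hyx, Real.norm_of_nonneg hS] using norm_inner_le_norm (𝕜 := ℂ) y x
  have hsq : S * S ≤ S * (R * ‖x‖ ^ 2) := by
    calc S * S ≤ ‖y‖ * ‖x‖ * (‖y‖ * ‖x‖) := mul_self_le_mul_self hS hSy
      _ = ‖y‖ ^ 2 * ‖x‖ ^ 2 := by ring
      _ ≤ R * S * ‖x‖ ^ 2 := by gcongr; exact hv s _
      _ = S * (R * ‖x‖ ^ 2) := by ring
  rcases hS.eq_or_lt with hS0 | hS0
  · rw [← hS0]; positivity
  · exact le_of_mul_le_mul_left hsq hS0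

theorem IsBesselBound.card_le_finrank {ι : Type*} {v : ι → H} {R : ℝ} (hv : IsBesselBound v R)
    (hR : 0 ≤ R) (hnorm : ∀ i, ‖v i‖ = 1) (E : Submodule ℂ H) [FiniteDimensional ℂ E]
    (s : Finset ι) (hs : ∀ i ∈ s, v i ∈ E) : (s.card : ℝ) ≤ R * Module.finrank ℂ E := by
  let e := stdOrthonormalBasis ℂ E
  have hparseval : ∀ i ∈ s, ∑ j, ‖inner ℂ (v i) (e j : H)‖ ^ 2 = 1 := by
    intro i hi
    have h := e.sum_sq_norm_inner_left (⟨v i, hs i hi⟩ : E)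
    simpa only [Submodule.coe_inner, Submodule.coe_norm, hnorm, one_pow] using h
  calc (s.card : ℝ) = ∑ i ∈ s, ∑ j, ‖inner ℂ (v i) (e j : H)‖ ^ 2 := by
        rw [Finset.sum_congr rfl hparseval, Finset.sum_const, nsmul_one]
    _ = ∑ j, ∑ i ∈ s, ‖inner ℂ (v i) (e j : H)‖ ^ 2 := Finset.sum_comm
    _ ≤ ∑ j, R * ‖(e j : H)‖ ^ 2 := Finset.sum_le_sum fun j _ => hv.sum_norm_inner_sq_le hR s _
    _ = R * Module.finrank ℂ E := by
        have hj : ∀ j, ‖(e j : H)‖ = 1 := e.orthonormal.1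
        simp [hj, mul_comm]

theorem exists_isBesselBound_of_isBoundedMatrix (hG : IsBoundedMatrix (gramEntry ψ)) :
    ∃ R : ℝ, 0 < R ∧ IsBesselBound ψ R := by
  obtain ⟨T, hT⟩ := hG
  refine ⟨‖T‖ + 1, by positivity, fun s c => ?_⟩
  -- `gramEntry` is linear in its first index, so the coefficients enter `ℓ²(ℤ)` conjugated.
  set w : L2Z := ∑ n ∈ s, lp.single 2 n (starRingEnd ℂ (c n)) with hw
  have hnorm : ‖w‖ ^ 2 = ∑ n ∈ s, ‖c n‖ ^ 2 := by
    simpa using lp.norm_sum_single (p := 2) (by norm_num) (fun n : ℤ => starRingEnd ℂ (c n)) s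
  have hTw : ∀ n, T w n = ∑ m ∈ s, starRingEnd ℂ (c m) * inner ℂ (ψ m) (ψ n) := by
    intro n
    have hsingle : ∀ m, (lp.single 2 m (starRingEnd ℂ (c m)) : L2Z) =
        starRingEnd ℂ (c m) • lp.single 2 m (1 : ℂ) := fun m => by
      rw [← lp.single_smul, smul_eq_mul, mul_one]
    simp only [hw, hsingle, map_sum, lp.coeFn_sum, Finset.sum_apply, map_smul, lp.coeFn_smul,
      Pi.smul_apply, hT, smul_eq_mul, gramEntry]
  have hform : ((‖∑ n ∈ s, c n • ψ n‖ ^ 2 : ℝ) : ℂ) = inner ℂ w (T w) := by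
    rw [Complex.ofReal_pow, ← Complex.coe_algebraMap, ← inner_self_eq_norm_sq_to_K (𝕜 := ℂ),
      inner_sum]
    conv_rhs => rw [hw, sum_inner, ← hw]
    refine Finset.sum_congr rfl fun n _ => ?_
    simp only [lp.inner_single_left, hTw, inner_smul_right, sum_inner, inner_smul_left,
      RCLike.inner_apply, Complex.conj_conj]
    rw [mul_comm]
  calc ‖∑ n ∈ s, c n • ψ n‖ ^ 2 = ‖inner ℂ w (T w)‖ := by
        rw [← hform, Complex.norm_real, Real.norm_of_nonneg (sq_nonneg _)]
    _ ≤ ‖w‖ * (‖T‖ * ‖w‖) := (norm_inner_le_norm _ _).trans (by gcongr; exact T.le_opNorm w)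
    _ ≤ (‖T‖ + 1) * ‖w‖ ^ 2 := by nlinarith [sq_nonneg ‖w‖]
    _ = (‖T‖ + 1) * ∑ n ∈ s, ‖c n‖ ^ 2 := by rw [hnorm]

theorem IsAdmissible.summable_norm_gramEntry_sq (hψ : IsAdmissible ψ) :
    Summable fun n => ‖gramEntry ψ n 0‖ ^ 2 := by
  obtain ⟨T, hT⟩ := hψ.bounded
  have h := (lp.memℓp (T (lp.single 2 0 (1 : ℂ)))).summable (by norm_num)
  simpa only [hT, ENNReal.toReal_ofNat, Real.rpow_ofNat] using h

theorem IsAdmissible.gramEntry_add (hψ : IsAdmissible ψ) (n m k : ℤ) :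
    gramEntry ψ (n + k) (m + k) = gramEntry ψ n m := by
  induction k using Int.induction_on with
  | zero => simp
  | succ k ih => rw [← add_assoc, ← add_assoc, hψ.shift, ih]
  | pred k ih => rw [← ih, ← hψ.shift]; congr 1 <;> ring

theorem IsAdmissible.inner_eq_gramEntry_sub (hψ : IsAdmissible ψ) (m n : ℤ) :
    inner ℂ (ψ m) (ψ n) = gramEntry ψ (n - m) 0 := by
  rw [← hψ.gramEntry_add _ _ m, sub_add_cancel, zero_add]
  rfl

theorem IsAdmissible.norm_sum_smul_add (hψ : IsAdmissible ψ) {ι : Type*} (s : Finset ι)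
    (c : ι → ℂ) (f : ι → ℤ) (k : ℤ) :
    ‖∑ i ∈ s, c i • ψ (f i + k)‖ = ‖∑ i ∈ s, c i • ψ (f i)‖ := by
  have h : inner ℂ (∑ i ∈ s, c i • ψ (f i + k)) (∑ i ∈ s, c i • ψ (f i + k)) =
      inner ℂ (∑ i ∈ s, c i • ψ (f i)) (∑ i ∈ s, c i • ψ (f i)) := by
    simp_rw [sum_inner, inner_sum, inner_smul_left, inner_smul_right,
      hψ.inner_eq_gramEntry_sub, add_sub_add_right_eq_sub]
  rw [norm_eq_sqrt_re_inner (𝕜 := ℂ), h, ← norm_eq_sqrt_re_inner]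

theorem IsAdmissible.exists_mem_span_Ico_of_not_linearIndependent (hψ : IsAdmissible ψ)
    (h : ¬LinearIndependent ℂ ψ) :
    ∃ a b : ℤ, ∀ k, ψ (b + k) ∈ Submodule.span ℂ (ψ '' Set.Ico (a + k) (b + k)) := by
  obtain ⟨c, hc, hne⟩ := not_linearIndependent_iff_finsupp.1 h
  have hsupp : c.support.Nonempty := Finsupp.support_nonempty_iff.2 hne
  set b := c.support.max' hsupp
  have hb : b ∈ c.support := c.support.max'_mem hsupp
  refine ⟨c.support.min' hsupp, b, fun k => ?_⟩
  have hshift : ∑ n ∈ c.support, c n • ψ (n + k) = 0 := by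
    rw [← norm_eq_zero, hψ.norm_sum_smul_add c.support c (fun n => n)]
    exact norm_eq_zero.2 hc
  rw [← Finset.add_sum_erase _ _ hb, add_eq_zero_iff_eq_neg] at hshift
  rw [← Submodule.smul_mem_iff _ (Finsupp.mem_support_iff.1 hb), hshift]
  refine neg_mem (sum_mem fun n hn => Submodule.smul_mem _ _ (Submodule.subset_span ?_))
  have hns := Finset.mem_of_mem_erase hn
  refine ⟨n + k, ⟨?_, ?_⟩, rfl⟩
  · grind [c.support.min'_le n hns]
  · grind [c.support.le_max' n hns]

theorem IsAdmissible.linearIndependent (hψ : IsAdmissible ψ) : LinearIndependent ℂ ψ := by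
  by_contra hdep
  obtain ⟨a, b, hab⟩ := hψ.exists_mem_span_Ico_of_not_linearIndependent hdep
  set E := Submodule.span ℂ (ψ '' Set.Ico a b)
  have hmem : ∀ k : ℕ, ψ (a + k) ∈ E := by
    intro k
    induction k using Nat.strong_induction_on with
    | _ k ih =>
      rcases lt_or_ge (a + k) b with hlt | hge
      · exact Submodule.subset_span ⟨a + k, by simp [hlt], rfl⟩
      · have h := hab (a + k - b)
        rw [add_sub_cancel] at h
        refine Submodule.span_le.2 ?_ h
        rintro _ ⟨n, ⟨han, hn⟩, rfl⟩
        obtain ⟨j, rfl⟩ := Int.le.dest (show a ≤ n by omega)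
        exact ih j (by omega)
  obtain ⟨R, hR, hbessel⟩ := exists_isBesselBound_of_isBoundedMatrix hψ.bounded
  have : FiniteDimensional ℂ E :=
    FiniteDimensional.span_of_finite ℂ ((Set.finite_Ico a b).image ψ)
  obtain ⟨K, hK⟩ := exists_nat_gt (R * Module.finrank ℂ E)
  have hcard := hbessel.card_le_finrank hR.le hψ.norm_eq_one E
    ((Finset.range K).image fun k : ℕ => a + k) (by simpa using fun k _ => hmem k)
  rw [Finset.card_image_of_injective _ (fun x y h => by simpa using h), Finset.card_range] at hcard
  linarith

end Admissible

section Truncation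

variable {H : Type*} [NormedAddCommGroup H] [InnerProductSpace ℂ H]
variable {ι κ : Type*} [Fintype ι] [DecidableEq ι] [Fintype κ] [DecidableEq κ]

theorem integral_sum_finrank_eigenspace_frameOp (v : ι → H) (f : ℝ → ℝ) :
    ∫ x, f x ∂(Measure.sum fun x : {x : ℝ // x ≠ 0} =>
      (Module.finrank ℂ
        (Module.End.eigenspace (frameOp v : H →ₗ[ℂ] H) ((x : ℝ) : ℂ)) : ℝ≥0∞) •
          Measure.dirac (x : ℝ)) =
      ∑ i, if gramEig v i = 0 then 0 else f (gramEig v i) := by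
  rw [sum_finrank_eigenspace_frameOp_dirac, integral_finsetSum_measure]
  · refine Finset.sum_congr rfl fun i _ => ?_
    split_ifs
    · simp
    · rw [integral_dirac]
  · intro i _
    split_ifs
    · simp
    · exact integrable_dirac (by simp)

theorem sum_gramEig_pow_eq_of_frameOp_eq {v : ι → H} {w : κ → H} (h : frameOp v = frameOp w)
    {k : ℕ} (hk : k ≠ 0) : ∑ i, gramEig v i ^ k = ∑ i, gramEig w i ^ k := by
  have hpow : ∀ x : ℝ, (if x = 0 then 0 else x ^ k) = x ^ k := by
    intro x
    split_ifs with hx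
    · rw [hx, zero_pow hk]
    · rfl
  have hv := integral_sum_finrank_eigenspace_frameOp v (· ^ k)
  have hw := integral_sum_finrank_eigenspace_frameOp w (· ^ k)
  simp only [hpow] at hv hw
  rw [← hv, ← hw, h]

omit [DecidableEq ι] [DecidableEq κ] in
theorem frameOp_comp_of_eq_zero (v : ι → H) {f : κ → ι} (hf : Function.Injective f)
    (hv : ∀ i ∉ Set.range f, v i = 0) : frameOp (v ∘ f) = frameOp v :=
  Fintype.sum_of_injective f hf _ _ (fun i hi => by simp [hv i hi]) fun _ => rfl

theorem IsBesselBound.indicator {ι : Type*} {v : ι → H} {R : ℝ} (hv : IsBesselBound v R)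
    (hR : 0 ≤ R) (s : Set ι) : IsBesselBound (s.indicator v) R := by
  classical
  have h := hv.smul hR (c := s.indicator 1) (M := 1) fun i => by
    by_cases hi : i ∈ s <;> simp [hi]
  rw [mul_one] at h
  convert h using 2 with i
  by_cases hi : i ∈ s <;> simp [hi]

theorem IsBesselBound.norm_sq_le {ι : Type*} {v : ι → H} {R : ℝ} (hv : IsBesselBound v R)
    (i : ι) : ‖v i‖ ^ 2 ≤ R := by
  simpa using hv {i} 1

theorem IsBesselBound.sum_norm_inner_sub_indicator_sq_le {v : ι → H} {R : ℝ}
    (hv : IsBesselBound v R) (hR : 0 ≤ R) (s : Finset ι) :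
    ∑ i, ∑ j, ‖inner ℂ (v i) (v j) -
        inner ℂ ((s : Set ι).indicator v i) ((s : Set ι).indicator v j)‖ ^ 2 ≤
      2 * R ^ 2 * (sᶜ.card : ℝ) := by
  set g : ι → ι → ℝ := fun i j => ‖inner ℂ (v i) (v j)‖ ^ 2
  have hterm : ∀ i j, ‖inner ℂ (v i) (v j) -
        inner ℂ ((s : Set ι).indicator v i) ((s : Set ι).indicator v j)‖ ^ 2 ≤
      (if i ∈ sᶜ then g i j else 0) + if j ∈ sᶜ then g i j else 0 := by
    intro i j
    by_cases hi : i ∈ s <;> by_cases hj : j ∈ s <;> simp [hi, hj, g]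
  have hrow : ∀ i, ∑ j, g j i ≤ R ^ 2 := fun i => by
    rw [sq R]
    exact (hv.sum_norm_inner_sq_le hR Finset.univ (v i)).trans (by gcongr; exact hv.norm_sq_le i)
  have hsum : ∑ i ∈ sᶜ, ∑ j, g j i ≤ R ^ 2 * (sᶜ.card : ℝ) := by
    rw [mul_comm, ← nsmul_eq_mul]
    exact Finset.sum_le_card_nsmul _ _ _ fun i _ => hrow i
  calc _ ≤ ∑ i, ∑ j, ((if i ∈ sᶜ then g i j else 0) + if j ∈ sᶜ then g i j else 0) :=
        Finset.sum_le_sum fun i _ => Finset.sum_le_sum fun j _ => hterm i j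
    _ = ∑ i ∈ sᶜ, ∑ j, g i j + ∑ j ∈ sᶜ, ∑ i, g i j := by
        simp only [Finset.sum_add_distrib, Finset.sum_ite_irrel, Finset.sum_const_zero]
        rw [Finset.sum_comm (f := fun i j => if j ∈ sᶜ then g i j else 0)]
        simp only [Finset.sum_ite_irrel, Finset.sum_const_zero, Finset.sum_ite_mem,
          Finset.univ_inter]
    _ = 2 * ∑ j ∈ sᶜ, ∑ i, g i j := by
        simp only [g, norm_inner_symm (v _) (v _), two_mul]
    _ ≤ 2 * R ^ 2 * (sᶜ.card : ℝ) := by rw [mul_assoc]; gcongr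

theorem IsBesselBound.abs_sum_gramEig_pow_sub_comp_le {v : ι → H} {R : ℝ}
    (hv : IsBesselBound v R) (hR : 0 ≤ R) {f : κ → ι} (hf : Function.Injective f) {k : ℕ}
    (hk : k ≠ 0) :
    |∑ i, gramEig v i ^ k - ∑ j, gramEig (v ∘ f) j ^ k| ≤
      √(Fintype.card ι) * (k * R ^ (k - 1)) *
        √(2 * R ^ 2 * (Fintype.card ι - Fintype.card κ)) := by
  set s : Finset ι := Finset.univ.map ⟨f, hf⟩
  have hcomp : (s : Set ι).indicator v ∘ f = v ∘ f :=
    funext fun j => Set.indicator_of_mem (by simp [s]) v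
  have hframe : frameOp (v ∘ f) = frameOp ((s : Set ι).indicator v) := by
    rw [← hcomp]
    exact frameOp_comp_of_eq_zero _ hf fun i hi => Set.indicator_of_notMem (by simpa [s] using hi) v
  have hcard : (sᶜ.card : ℝ) = Fintype.card ι - Fintype.card κ := by
    rw [Finset.card_compl, Nat.cast_sub (Finset.card_le_univ s), Finset.card_map, Finset.card_univ]
  rw [sum_gramEig_pow_eq_of_frameOp_eq hframe hk, ← hcard]
  refine (abs_sum_gramEig_pow_sub_le hR hv (hv.indicator hR s) k).trans ?_
  gcongr
  exact hv.sum_norm_inner_sub_indicator_sq_le hR s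

theorem IsBesselBound.abs_sum_gramEig_pow_sub_sum_blocks_le {v : ι × κ → H} {R : ℝ}
    (hv : IsBesselBound v R) (hR : 0 ≤ R) (k : ℕ) :
    |∑ p, gramEig v p ^ k - ∑ b, ∑ i, gramEig (fun i => v (i, b)) i ^ k| ≤
      √(Fintype.card (ι × κ)) * (k * R ^ (k - 1)) *
        √(∑ p, ∑ q, if p.2 = q.2 then 0 else ‖inner ℂ (v p) (v q)‖ ^ 2) := by
  rw [← sum_gramEig_blockFamily_pow]
  refine (abs_sum_gramEig_pow_sub_le hR hv hv.blockFamily k).trans_eq ?_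
  congr! 5 with p _ q
  rw [inner_blockFamily]
  split_ifs <;> simp

end Truncation

section Windows

variable {H : Type*} [NormedAddCommGroup H] [InnerProductSpace ℂ H]

/-- The site in position `i` of the `b`-th block, when `ℤ` is cut into blocks of length `L`. -/
def blockSite (L : ℕ) (i : Fin L) (b : ℤ) : ℤ := b * L + (i : ℕ)

theorem blockSite_ediv {L : ℕ} (i : Fin L) (b : ℤ) : blockSite L i b / L = b := by
  have hL : (L : ℤ) ≠ 0 := by have := i.pos; omega
  rw [blockSite, Int.add_comm, Int.add_mul_ediv_right _ _ hL,
    Int.ediv_eq_zero_of_lt (by omega) (by omega), zero_add]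

theorem blockSite_injective (L : ℕ) :
    Function.Injective fun p : Fin L × ℤ => blockSite L p.1 p.2 := by
  rintro ⟨i, b⟩ ⟨j, c⟩ h
  obtain rfl : b = c := by simpa [blockSite_ediv] using congrArg (· / (L : ℤ)) h
  have hij : ((i : ℕ) : ℤ) = (j : ℕ) := add_left_cancel h
  rw [Fin.ext (Int.ofNat_inj.1 hij)]

theorem card_filter_add_ediv_ne_zero_le (L : ℕ) (d : ℤ) :
    ((Finset.univ.filter fun i : Fin L => ((i : ℕ) + d) / (L : ℤ) ≠ 0).card : ℝ) ≤
      L * min (|(d : ℝ)| / L) 1 := by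
  rcases L.eq_zero_or_pos with rfl | hL
  · simp
  have hdist : (Finset.univ.filter fun i : Fin L => ((i : ℕ) + d) / (L : ℤ) ≠ 0).card ≤
      d.natAbs := by
    calc _ ≤ (Finset.Ico (L - d) L ∪ Finset.Ico 0 (-d)).card := by
          refine Finset.card_le_card_of_injOn (fun i => ((i : ℕ) : ℤ)) (fun i hi => ?_)
            fun i _ j _ h => Fin.ext (Int.ofNat_inj.1 h)
          have hi' : ¬(0 ≤ (i : ℕ) + d ∧ (i : ℕ) + d < L) := fun h =>
            (Finset.mem_filter.1 hi).2 (Int.ediv_eq_zero_of_lt h.1 h.2)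
          simp only [Finset.coe_union, Finset.coe_Ico, Set.mem_union, Set.mem_Ico]
          omega
      _ ≤ (Finset.Ico (L - d) L).card + (Finset.Ico 0 (-d)).card := Finset.card_union_le _ _
      _ ≤ d.natAbs := by rw [Int.card_Ico, Int.card_Ico]; omega
  have hL' : (0 : ℝ) < L := by exact_mod_cast hL
  rw [mul_min_of_nonneg _ _ hL'.le, mul_div_cancel₀ _ hL'.ne', mul_one, le_min_iff]
  constructor
  · rw [← Int.cast_abs, Int.abs_eq_natAbs]
    exact_mod_cast hdist
  · exact_mod_cast (Finset.card_le_univ _).trans_eq (Fintype.card_fin L)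

/-- An upper bound, per site, for the part of a summable interaction `h` (with `h d` the strength at
distance `d`) that couples different blocks of length `L`: for each `d`, at most `min |d| L` of the
`L` sites of a block are moved out of it by `d`. -/
noncomputable def interblockCoupling (h : ℤ → ℝ) (L : ℕ) : ℝ :=
  ∑' d : ℤ, min (|(d : ℝ)| / L) 1 * h d

theorem summable_interblockCoupling {h : ℤ → ℝ} (h_nonneg : ∀ d, 0 ≤ h d) (hh : Summable h)
    (L : ℕ) : Summable fun d : ℤ => min (|(d : ℝ)| / L) 1 * h d :=
  Summable.of_nonneg_of_le (fun d => mul_nonneg (by positivity) (h_nonneg d))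
    (fun d => mul_le_of_le_one_left (h_nonneg d) (min_le_right _ _)) hh

theorem tendsto_interblockCoupling {h : ℤ → ℝ} (h_nonneg : ∀ d, 0 ≤ h d) (hh : Summable h) :
    Tendsto (interblockCoupling h) atTop (𝓝 0) := by
  rw [← tsum_zero (β := ℤ)]
  refine tendsto_tsum_of_dominated_convergence hh (fun d => ?_) (.of_forall fun L d => ?_)
  · have hd : Tendsto (fun L : ℕ => min (|(d : ℝ)| / L) 1) atTop (𝓝 0) := by
      simpa using (tendsto_const_div_atTop_nhds_zero_nat |(d : ℝ)|).min
        (tendsto_const_nhds (x := (1 : ℝ)))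
    simpa using hd.mul_const (h d)
  · rw [Real.norm_of_nonneg (mul_nonneg (by positivity) (h_nonneg d))]
    exact mul_le_of_le_one_left (h_nonneg d) (min_le_right _ _)

/-- The total strength, under the interaction `h`, of the displacements that move the `i`-th site of
a block of length `L` out of the block. -/
noncomputable def exitCoupling (h : ℤ → ℝ) {L : ℕ} (i : Fin L) : ℝ :=
  ∑' d : ℤ, if ((i : ℕ) + d) / (L : ℤ) ≠ 0 then h d else 0

theorem summable_exitCoupling {h : ℤ → ℝ} (h_nonneg : ∀ d, 0 ≤ h d) (hh : Summable h) {L : ℕ}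
    (i : Fin L) : Summable fun d : ℤ => if ((i : ℕ) + d) / (L : ℤ) ≠ 0 then h d else 0 :=
  Summable.of_nonneg_of_le (fun d => by split_ifs <;> simp [h_nonneg])
    (fun d => by split_ifs <;> simp [h_nonneg]) hh

theorem sum_exitCoupling_le {h : ℤ → ℝ} (h_nonneg : ∀ d, 0 ≤ h d) (hh : Summable h) (L : ℕ) :
    ∑ i : Fin L, exitCoupling h i ≤ L * interblockCoupling h L := by
  simp only [exitCoupling]
  rw [← Summable.tsum_finsetSum fun i _ => summable_exitCoupling h_nonneg hh i,
    interblockCoupling, ← tsum_mul_left]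
  refine Summable.tsum_le_tsum (fun d => ?_)
    (summable_sum fun i _ => summable_exitCoupling h_nonneg hh i)
    ((summable_interblockCoupling h_nonneg hh L).mul_left _)
  rw [← Finset.sum_filter, Finset.sum_const, nsmul_eq_mul, ← mul_assoc]
  exact mul_le_mul_of_nonneg_right (card_filter_add_ediv_ne_zero_le L d) (h_nonneg d)

theorem sum_interblock_le_exitCoupling {h : ℤ → ℝ} (h_nonneg : ∀ d, 0 ≤ h d) (hh : Summable h)
    {L : ℕ} {B : Finset ℤ} (p : Fin L × B) :
    ∑ q : Fin L × B, (if p.2 = q.2 then 0 else h (blockSite L q.1 q.2 - blockSite L p.1 p.2)) ≤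
      exitCoupling h p.1 := by
  have hinj : Function.Injective fun q : Fin L × B =>
      blockSite L q.1 q.2 - blockSite L p.1 p.2 := fun q q' hq => by
    have := blockSite_injective L (a₁ := (q.1, (q.2 : ℤ))) (a₂ := (q'.1, (q'.2 : ℤ)))
      (by simpa using hq)
    grind
  have hsum := (summable_exitCoupling h_nonneg hh p.1).sum_le_tsum (Finset.univ.map ⟨_, hinj⟩)
    (fun d _ => by split_ifs <;> simp [h_nonneg])
  rw [Finset.sum_map] at hsum
  refine (Finset.sum_congr rfl fun q _ => ?_).trans_le hsum
  have hdiv : ((p.1 : ℕ) + (blockSite L q.1 q.2 - blockSite L p.1 p.2)) / (L : ℤ) =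
      q.2 - p.2 := by
    rw [← blockSite_ediv q.1 (q.2 - p.2)]
    congr 1
    simp only [blockSite]
    ring
  simp only [Function.Embedding.coeFn_mk, hdiv, ne_eq, sub_eq_zero, ite_not, Subtype.ext_iff,
    eq_comm]

theorem sum_interblock_le {h : ℤ → ℝ} (h_nonneg : ∀ d, 0 ≤ h d) (hh : Summable h) (L : ℕ)
    (B : Finset ℤ) :
    ∑ p : Fin L × B, ∑ q : Fin L × B,
        (if p.2 = q.2 then 0 else h (blockSite L q.1 q.2 - blockSite L p.1 p.2)) ≤
      B.card * L * interblockCoupling h L := by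
  calc _ ≤ ∑ p : Fin L × B, exitCoupling h p.1 :=
        Finset.sum_le_sum fun p _ => sum_interblock_le_exitCoupling h_nonneg hh p
    _ = B.card * ∑ i : Fin L, exitCoupling h i := by
        rw [Fintype.sum_prod_type_right]
        simp only [Finset.sum_const, Finset.card_univ, Fintype.card_coe, nsmul_eq_mul]
    _ ≤ B.card * L * interblockCoupling h L := by
        rw [mul_assoc]
        gcongr
        exact sum_exitCoupling_le h_nonneg hh L

theorem card_Icc_neg_self (N : ℕ) : (Finset.Icc (-(N : ℤ)) N).card = 2 * N + 1 := by
  rw [Int.card_Icc]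
  omega

theorem card_Ico_neg_self (m : ℕ) : (Finset.Ico (-(m : ℤ)) m).card = 2 * m := by
  rw [Int.card_Ico]
  omega

/-- The blocks of length `L` with index in `[-(N / L), N / L)`, all of which lie inside the window
`[-N, N]`. -/
noncomputable abbrev windowBlocks (L N : ℕ) : Finset ℤ :=
  Finset.Ico (-((N / L : ℕ) : ℤ)) (N / L : ℕ)

theorem blockSite_mem_Icc {L N : ℕ} (i : Fin L) {b : ℤ} (hb : b ∈ windowBlocks L N) :
    blockSite L i b ∈ Finset.Icc (-(N : ℤ)) N := by
  obtain ⟨hb₁, hb₂⟩ := Finset.mem_Ico.1 hb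
  have hdiv : ((N / L : ℕ) : ℤ) * L ≤ N := by exact_mod_cast Nat.div_mul_le_self N L
  have hi := i.isLt
  simp only [Finset.mem_Icc, blockSite]
  constructor <;> nlinarith

/-- An enumeration of the sites of the window `[-N, N]` that belong to a block contained in it. -/
noncomputable def windowSite (L N : ℕ) (p : Fin L × windowBlocks L N) : Finset.Icc (-(N : ℤ)) N :=
  ⟨blockSite L p.1 p.2, blockSite_mem_Icc p.1 p.2.2⟩

theorem windowSite_injective (L N : ℕ) : Function.Injective (windowSite L N) := fun p q hpq => by
  have := blockSite_injective L (a₁ := (p.1, (p.2 : ℤ))) (a₂ := (q.1, (q.2 : ℤ)))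
    (congrArg Subtype.val hpq)
  grind

theorem card_blocks_mul_le (L N : ℕ) :
    (Fintype.card (Fin L × windowBlocks L N) : ℝ) ≤ 2 * N + 1 := by
  have hdiv : 2 * (L * (N / L)) ≤ 2 * N + 1 := by have := Nat.mul_div_le N L; omega
  rw [Fintype.card_prod, Fintype.card_fin, Fintype.card_coe, card_Ico_neg_self, mul_left_comm]
  exact_mod_cast hdiv

theorem two_mul_add_one_sub_card_blocks_le {L : ℕ} (hL : 0 < L) (N : ℕ) :
    (2 * N + 1 : ℝ) - Fintype.card (Fin L × windowBlocks L N) ≤ 2 * L := by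
  have hdiv : 2 * N + 1 ≤ 2 * L + 2 * (L * (N / L)) := by
    have := Nat.lt_mul_div_succ N hL
    rw [Nat.mul_add] at this
    omega
  rw [Fintype.card_prod, Fintype.card_fin, Fintype.card_coe, card_Ico_neg_self, mul_left_comm,
    sub_le_iff_le_add]
  exact_mod_cast hdiv

variable {w : ℤ → H} {R : ℝ}

theorem IsBesselBound.abs_sum_gramEig_window_pow_sub_comp_windowSite_le (hw : IsBesselBound w R)
    (hR : 0 ≤ R) {L : ℕ} (hL : 0 < L) {k : ℕ} (hk : k ≠ 0) (N : ℕ) :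
    |∑ n, gramEig (fun n : Finset.Icc (-(N : ℤ)) N => w n) n ^ k -
        ∑ p, gramEig (fun p => w (windowSite L N p)) p ^ k| ≤
      k * R ^ (k - 1) * √((2 * N + 1) * (4 * L * R ^ 2)) := by
  have hcut := (hw.comp Subtype.val_injective).abs_sum_gramEig_pow_sub_comp_le hR
    (windowSite_injective L N) hk
  rw [Fintype.card_coe, card_Icc_neg_self] at hcut
  push_cast at hcut
  refine hcut.trans ?_
  rw [mul_comm √_, mul_assoc, ← Real.sqrt_mul (by positivity)]
  refine mul_le_mul_of_nonneg_left (Real.sqrt_le_sqrt ?_) (by positivity)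
  refine mul_le_mul_of_nonneg_left ?_ (by positivity)
  linarith [mul_le_mul_of_nonneg_left (two_mul_add_one_sub_card_blocks_le hL N)
    (by positivity : 0 ≤ 2 * R ^ 2)]

theorem IsBesselBound.abs_sum_gramEig_comp_windowSite_pow_sub_sum_blocks_le
    (hw : IsBesselBound w R) (hR : 0 ≤ R) {h : ℤ → ℝ} (hh : Summable h)
    (hwh : ∀ m n, ‖inner ℂ (w m) (w n)‖ ^ 2 ≤ h (n - m)) (L k N : ℕ) :
    |∑ p, gramEig (fun p => w (windowSite L N p)) p ^ k -
        ∑ b ∈ windowBlocks L N, ∑ i, gramEig (fun i : Fin L => w (blockSite L i b)) i ^ k| ≤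
      k * R ^ (k - 1) * ((2 * N + 1) * √(interblockCoupling h L)) := by
  have h_nonneg : ∀ d, 0 ≤ h d := fun d => by simpa using (sq_nonneg _).trans (hwh 0 d)
  set M : ℝ := (Fintype.card (Fin L × windowBlocks L N) : ℝ)
  have hcoupling : ∑ p, ∑ q, (if p.2 = q.2 then 0 else
      ‖inner ℂ (w (windowSite L N p)) (w (windowSite L N q))‖ ^ 2) ≤
        M * interblockCoupling h L := by
    rw [show M = (windowBlocks L N).card * L by simp [M, mul_comm]]
    refine le_trans ?_ (sum_interblock_le h_nonneg hh L _)
    gcongr with p _ q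
    split_ifs
    · rfl
    · exact hwh _ _
  have hsplit := ((hw.comp Subtype.val_injective).comp
    (windowSite_injective L N)).abs_sum_gramEig_pow_sub_sum_blocks_le hR k
  rw [← Finset.sum_coe_sort (windowBlocks L N)]
  calc _ ≤ √M * (k * R ^ (k - 1)) * √(M * interblockCoupling h L) := by
        refine hsplit.trans ?_
        gcongr
        exact hcoupling
    _ = k * R ^ (k - 1) * (M * √(interblockCoupling h L)) := by
        rw [mul_comm √M, mul_assoc, Real.sqrt_mul (Nat.cast_nonneg _), ← mul_assoc √M,
          Real.mul_self_sqrt (Nat.cast_nonneg _)]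
    _ ≤ _ := by
        gcongr
        exact card_blocks_mul_le L N

theorem IsBesselBound.abs_sum_gramEig_window_pow_sub_sum_blocks_le (hw : IsBesselBound w R)
    (hR : 0 ≤ R) {h : ℤ → ℝ} (hh : Summable h)
    (hwh : ∀ m n, ‖inner ℂ (w m) (w n)‖ ^ 2 ≤ h (n - m)) {L : ℕ} (hL : 0 < L)
    {k : ℕ} (hk : k ≠ 0) (N : ℕ) :
    |(∑ n, gramEig (fun n : Finset.Icc (-(N : ℤ)) N => w n) n ^ k) / (2 * N + 1) -
        (∑ b ∈ windowBlocks L N, ∑ i, gramEig (fun i : Fin L => w (blockSite L i b)) i ^ k) /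
          (2 * N + 1)| ≤
      k * R ^ (k - 1) * (√(4 * L * R ^ 2 / (2 * N + 1)) + √(interblockCoupling h L)) := by
  have hN : (0 : ℝ) < 2 * N + 1 := by positivity
  rw [← sub_div, abs_div, abs_of_pos hN, div_le_iff₀ hN]
  calc _ ≤ k * R ^ (k - 1) * √((2 * N + 1) * (4 * L * R ^ 2)) +
        k * R ^ (k - 1) * ((2 * N + 1) * √(interblockCoupling h L)) :=
        (abs_sub_le _ _ _).trans (add_le_add
          (hw.abs_sum_gramEig_window_pow_sub_comp_windowSite_le hR hL hk N)
          (hw.abs_sum_gramEig_comp_windowSite_pow_sub_sum_blocks_le hR hh hwh L k N))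
    _ = _ := by
        have hsq : (2 * N + 1) * (4 * L * R ^ 2) =
            (2 * N + 1) ^ 2 * (4 * L * R ^ 2 / (2 * N + 1)) := by field_simp
        rw [hsq, Real.sqrt_mul (sq_nonneg _), Real.sqrt_sq hN.le]
        ring

end Windows

section Weighted

variable {H : Type*} [NormedAddCommGroup H] [InnerProductSpace ℂ H] {ι : Type*}

/-- The vectors `√(c i) • v i`. Their frame operator is `∑ c i ⟨·, v i⟩ v i` when `c` is
nonnegative, so the random weights are absorbed into the vectors. -/
noncomputable def weighted (v : ι → H) (c : ι → ℝ) (i : ι) : H := (√(c i) : ℂ) • v i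

theorem frameOp_weighted [Fintype ι] (v : ι → H) {c : ι → ℝ} (hc : ∀ i, 0 ≤ c i) :
    frameOp (weighted v c) = ∑ i, (c i : ℂ) • InnerProductSpace.rankOne ℂ (v i) (v i) := by
  refine Finset.sum_congr rfl fun i _ => ContinuousLinearMap.ext fun x => ?_
  have hsqrt : (√(c i) : ℂ) * √(c i) = c i := by
    rw [← Complex.ofReal_mul, Real.mul_self_sqrt (hc i)]
  simp only [weighted, InnerProductSpace.rankOne_apply, inner_smul_left, Complex.conj_ofReal,
    smul_smul, smul_apply]
  rw [mul_right_comm, hsqrt]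

theorem truncated_eq_frameOp (ψ : ℤ → H) {ϰ : ℤ → ℝ} (hϰ : ∀ n, 0 ≤ ϰ n) (N : ℕ) :
    truncated ψ ϰ N = frameOp fun n : Finset.Icc (-(N : ℤ)) N => weighted ψ ϰ n := by
  rw [truncated, ← Finset.sum_coe_sort]
  exact (frameOp_weighted (fun n : Finset.Icc (-(N : ℤ)) N => ψ n) fun n => hϰ n).symm

theorem norm_inner_weighted_sq_le (v : ι → H) {c : ι → ℝ} {κ : ℝ} (hc : ∀ i, 0 ≤ c i)
    (hκ : ∀ i, c i ≤ κ) (i j : ι) :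
    ‖inner ℂ (weighted v c i) (weighted v c j)‖ ^ 2 ≤ κ ^ 2 * ‖inner ℂ (v i) (v j)‖ ^ 2 := by
  simp only [weighted, inner_smul_left, inner_smul_right, norm_mul, Complex.norm_conj,
    Complex.norm_real, Real.norm_of_nonneg (Real.sqrt_nonneg _), mul_pow, Real.sq_sqrt (hc _)]
  rw [← mul_assoc, sq κ]
  have hκ0 : 0 ≤ κ := (hc j).trans (hκ j)
  exact mul_le_mul_of_nonneg_right (mul_le_mul (hκ j) (hκ i) (hc i) hκ0) (sq_nonneg _)

theorem IsBesselBound.weighted {v : ι → H} {R : ℝ} (hv : IsBesselBound v R) (hR : 0 ≤ R)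
    {c : ι → ℝ} {κ : ℝ} (hc : ∀ i, 0 ≤ c i) (hκ : ∀ i, c i ≤ κ) :
    IsBesselBound (weighted v c) (R * κ) :=
  hv.smul hR fun i => by
    rw [Complex.norm_real, Real.norm_of_nonneg (Real.sqrt_nonneg _), Real.sq_sqrt (hc i)]
    exact hκ i

theorem linearIndependent_weighted {v : ι → H} (hv : LinearIndependent ℂ v) {c : ι → ℝ}
    (hc : ∀ i, 0 < c i) : LinearIndependent ℂ (weighted v c) :=
  hv.units_smul fun i =>
    Units.mk0 (√(c i) : ℂ) (Complex.ofReal_ne_zero.2 (Real.sqrt_pos.2 (hc i)).ne')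

/-- The trace of the `k`-th power of the frame operator of the vectors `√(c i) • v i`. -/
noncomputable def weightedMoment [Fintype ι] [DecidableEq ι] (v : ι → H) (k : ℕ) (c : ι → ℝ) : ℝ :=
  ∑ i, gramEig (weighted v c) i ^ k

variable [Fintype ι] [DecidableEq ι]

theorem weightedMoment_congr {v w : ι → H} (h : ∀ i j, inner ℂ (v i) (v j) = inner ℂ (w i) (w j))
    (k : ℕ) (c : ι → ℝ) : weightedMoment v k c = weightedMoment w k c := by
  have hgram : Matrix.gram ℂ (weighted v c) = Matrix.gram ℂ (weighted w c) := by
    ext i j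
    simp only [Matrix.gram_apply, weighted, inner_smul_left, inner_smul_right, h]
  rw [weightedMoment, weightedMoment, gramEig_congr hgram]

theorem continuous_weightedMoment (v : ι → H) (k : ℕ) : Continuous (weightedMoment v k) := by
  have htrace : weightedMoment v k = fun c => (Matrix.gram ℂ (weighted v c) ^ k).trace.re :=
    funext fun c => by rw [← sum_gramEig_pow, Complex.ofReal_re, weightedMoment]
  have hgram : Continuous fun c : ι → ℝ => Matrix.gram ℂ (weighted v c) := by
    refine continuous_matrix fun i j => ?_
    simp only [Matrix.gram_apply, weighted]
    fun_prop
  rw [htrace]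
  exact Complex.continuous_re.comp (hgram.pow k).matrix_trace

theorem IsBesselBound.abs_weightedMoment_le {v : ι → H} {R : ℝ} (hv : IsBesselBound v R)
    (hR : 0 ≤ R) {c : ι → ℝ} {κ : ℝ} (hc : ∀ i, 0 ≤ c i) (hκ : ∀ i, c i ≤ κ) (k : ℕ) :
    |weightedMoment v k c| ≤ Fintype.card ι * (R * κ) ^ k := by
  have h_nonneg : 0 ≤ ∑ i, gramEig (RankOneSum.weighted v c) i ^ k :=
    Finset.sum_nonneg fun i _ => pow_nonneg (gramEig_nonneg _ i) k
  rw [weightedMoment, abs_of_nonneg h_nonneg, ← nsmul_eq_mul]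
  exact Finset.sum_le_card_nsmul _ _ _ fun i _ =>
    pow_le_pow_left₀ (gramEig_nonneg _ i) (gramEig_le (hv.weighted hR hc hκ) i) k

end Weighted

section StrongLaw

open ProbabilityTheory

variable {X : Type*} [MeasurableSpace X] (P : Measure X) [IsProbabilityMeasure P]

theorem ae_infinitePi_forall {ι : Type*} [Countable ι] {p : X → Prop} (hp : ∀ᵐ x ∂P, p x) :
    ∀ᵐ ω ∂(Measure.infinitePi fun _ : ι => P), ∀ n, p (ω n) :=
  ae_all_iff.2 fun n =>
    (measurePreserving_eval_infinitePi (fun _ : ι => P) n).quasiMeasurePreserving.ae hp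

theorem ae_tendsto_average_infinitePi {F : X → ℝ} (hF : Measurable F) (hint : Integrable F P) :
    ∀ᵐ ω ∂(Measure.infinitePi fun _ : ℕ => P),
      Tendsto (fun m : ℕ => (∑ j ∈ Finset.range m, F (ω j)) / m) atTop (𝓝 (∫ x, F x ∂P)) := by
  have heval := measurePreserving_eval_infinitePi fun _ : ℕ => P
  have hmean : ∫ ω, F (ω 0) ∂(Measure.infinitePi fun _ : ℕ => P) = ∫ x, F x ∂P :=
    (heval 0).hasLaw.integral_comp hF.aestronglyMeasurable
  have hindep : iIndepFun (fun (j : ℕ) (ω : ℕ → X) => F (ω j)) (Measure.infinitePi fun _ => P) :=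
    iIndepFun_infinitePi fun _ => hF
  have hident : ∀ i, IdentDistrib (fun ω : ℕ → X => F (ω i)) (fun ω => F (ω 0))
      (Measure.infinitePi fun _ => P) (Measure.infinitePi fun _ => P) := fun i =>
    IdentDistrib.comp ⟨(heval i).aemeasurable, (heval 0).aemeasurable,
      (heval i).map_eq.trans (heval 0).map_eq.symm⟩ hF
  have hslln := strong_law_ae_real (fun (j : ℕ) (ω : ℕ → X) => F (ω j))
    ((heval 0).integrable_comp_of_integrable hint) (fun i j hij => hindep.indepFun hij) hident
  rwa [hmean] at hslln

theorem ae_tendsto_average_blocks {ι κ : Type*} {e : ℕ × κ → ι}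
    (he : Function.Injective e) {F : (κ → X) → ℝ} (hF : Measurable F)
    (hint : Integrable F (Measure.infinitePi fun _ : κ => P)) :
    ∀ᵐ ω ∂(Measure.infinitePi fun _ : ι => P),
      Tendsto (fun m : ℕ => (∑ j ∈ Finset.range m, F fun i => ω (e (j, i))) / m) atTop
        (𝓝 (∫ y, F y ∂(Measure.infinitePi fun _ : κ => P))) := by
  have hblocks : MeasurePreserving (fun (ω : ι → X) (j : ℕ) (i : κ) => ω (e (j, i)))
      (Measure.infinitePi fun _ : ι => P)
      (Measure.infinitePi fun _ : ℕ => Measure.infinitePi fun _ : κ => P) := by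
    refine ⟨by fun_prop, ?_⟩
    rw [← Measure.infinitePi_map_curry fun (_ : ℕ) (_ : κ) => P,
      ← Measure.map_infinitePi_infinitePi_of_inj (P := fun _ : ι => P) he,
      Measure.map_map (by fun_prop) (by fun_prop)]
    rfl
  exact hblocks.quasiMeasurePreserving.ae (ae_tendsto_average_infinitePi _ hF hint)

end StrongLaw

section Moments

theorem tendsto_limUnder_of_eventually_abs_sub_le {a c ε : ℕ → ℝ} (hε : Tendsto ε atTop (𝓝 0))
    (h : ∀ j, ∀ᶠ N in atTop, |a N - c j| ≤ ε j) : Tendsto a atTop (𝓝 (limUnder atTop c)) := by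
  have hcauchy : CauchySeq a := by
    refine Metric.cauchySeq_iff.2 fun δ hδ => ?_
    obtain ⟨j, hj⟩ := (hε.eventually (gt_mem_nhds (half_pos hδ))).exists
    obtain ⟨N₀, hN₀⟩ := eventually_atTop.1 (h j)
    refine ⟨N₀, fun m hm n hn => (dist_triangle_right _ _ (c j)).trans_lt ?_⟩
    rw [Real.dist_eq, Real.dist_eq]
    linarith [hN₀ m hm, hN₀ n hn]
  obtain ⟨l, hl⟩ := cauchySeq_tendsto_of_complete hcauchy
  have hc : Tendsto c atTop (𝓝 l) := by
    refine tendsto_iff_dist_tendsto_zero.2 (squeeze_zero (fun _ => dist_nonneg) (fun j => ?_) hε)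
    rw [dist_comm, Real.dist_eq]
    exact le_of_tendsto (hl.sub_const (c j)).abs (h j)
  rwa [hc.limUnder_eq]

theorem exists_ae_tendsto_of_ae_eventually_abs_sub_le {Ω : Type*} [MeasurableSpace Ω]
    {μ : Measure Ω} {a : Ω → ℕ → ℝ}
    (h : ∀ ε : ℝ, 0 < ε → ∃ c : ℝ, ∀ᵐ ω ∂μ, ∀ᶠ N in atTop, |a ω N - c| ≤ ε) :
    ∃ l : ℝ, ∀ᵐ ω ∂μ, Tendsto (a ω) atTop (𝓝 l) := by
  choose c hc using fun j : ℕ => h (1 / (j + 1)) Nat.one_div_pos_of_nat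
  exact ⟨limUnder atTop c, (ae_all_iff.2 hc).mono fun ω hω =>
    tendsto_limUnder_of_eventually_abs_sub_le tendsto_one_div_add_atTop_nhds_zero_nat hω⟩

theorem sum_Ico_neg_eq_sum_range (f : ℤ → ℝ) (m : ℕ) :
    ∑ b ∈ Finset.Ico (-(m : ℤ)) m, f b =
      ∑ j ∈ Finset.range (2 * m), f (Equiv.intEquivNat.symm j) := by
  induction m with
  | zero => simp
  | succ m ih =>
    have heven : Equiv.intEquivNat.symm (2 * m) = m := (Equiv.symm_apply_eq _).2 rfl
    have hodd : Equiv.intEquivNat.symm (2 * m + 1) = -1 - (m : ℤ) := by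
      rw [Equiv.symm_apply_eq, show -1 - (m : ℤ) = Int.negSucc m by omega]
      rfl
    have hinsert : Finset.Ico (-((m + 1 : ℕ) : ℤ)) (m + 1 : ℕ) =
        insert (-1 - (m : ℤ)) (insert (m : ℤ) (Finset.Ico (-(m : ℤ)) m)) := by
      ext x
      simp only [Finset.mem_Ico, Finset.mem_insert]
      omega
    rw [hinsert, Finset.sum_insert (by simp only [Finset.mem_Ico, Finset.mem_insert]; omega),
      Finset.sum_insert (by simp), ih, Nat.mul_succ, Finset.sum_range_succ, Finset.sum_range_succ,
      heven, hodd]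
    ring

theorem tendsto_const_div_two_mul_add_one (C : ℝ) :
    Tendsto (fun N : ℕ => C / (2 * N + 1)) atTop (𝓝 0) :=
  tendsto_const_nhds.div_atTop <| tendsto_atTop_add_const_right _ _ <|
    tendsto_natCast_atTop_atTop.const_mul_atTop two_pos

theorem tendsto_two_mul_div_div {L : ℕ} (hL : 0 < L) :
    Tendsto (fun N : ℕ => ((2 * (N / L) : ℕ) : ℝ) / (2 * N + 1)) atTop (𝓝 (L : ℝ)⁻¹) := by
  have hL' : (0 : ℝ) < L := by exact_mod_cast hL
  have hlower : Tendsto (fun N : ℕ => (L : ℝ)⁻¹ - 2 / (2 * N + 1)) atTop (𝓝 (L : ℝ)⁻¹) := by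
    simpa using (tendsto_const_div_two_mul_add_one 2).const_sub (L : ℝ)⁻¹
  refine tendsto_of_tendsto_of_tendsto_of_le_of_le hlower tendsto_const_nhds (fun N => ?_)
    fun N => ?_
  · have hdiv : (2 * N + 1 : ℝ) ≤ L * (2 * (N / L) : ℕ) + 2 * L := by
      have := Nat.lt_mul_div_succ N hL
      rw [Nat.mul_add] at this
      exact_mod_cast (by linarith : 2 * N + 1 ≤ L * (2 * (N / L)) + 2 * L)
    rw [sub_le_iff_le_add, ← add_div, inv_le_iff_one_le_mul₀' hL', mul_div_assoc', mul_add,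
      one_le_div (by positivity), mul_comm (L : ℝ) 2]
    exact hdiv
  · have hdiv : (L * (2 * (N / L) : ℕ) : ℝ) ≤ 2 * N + 1 := by
      have := Nat.mul_div_le N L
      exact_mod_cast (by linarith : L * (2 * (N / L)) ≤ 2 * N + 1)
    rwa [div_le_iff₀ (by positivity), le_inv_mul_iff₀ hL']

variable {H : Type*} [NormedAddCommGroup H] [InnerProductSpace ℂ H] {ψ : ℤ → H}

/-- The eigenvalues of the truncated operator on the span of `ψ_{-N}, …, ψ_N`, for positive `ϰ`.
They are enumerated by the indices of the window. -/
noncomputable def truncatedEig (ψ : ℤ → H) (ϰ : ℤ → ℝ) (N : ℕ) : Finset.Icc (-(N : ℤ)) N → ℝ :=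
  gramEig fun n : Finset.Icc (-(N : ℤ)) N => weighted ψ ϰ n

/-- The normalised trace of the `k`-th power of the truncated operator (for nonnegative `ϰ`). -/
noncomputable def traceMoment (ψ : ℤ → H) (ϰ : ℤ → ℝ) (N k : ℕ) : ℝ :=
  (∑ n, truncatedEig ψ ϰ N n ^ k) / (2 * N + 1)

theorem IsAdmissible.weightedMoment_blockSite (hψ : IsAdmissible ψ) (L k : ℕ) (b : ℤ) :
    weightedMoment (fun i : Fin L => ψ (blockSite L i b)) k =
      weightedMoment (fun i : Fin L => ψ (blockSite L i 0)) k :=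
  funext fun c => weightedMoment_congr (fun i j => by
    rw [hψ.inner_eq_gramEntry_sub, hψ.inner_eq_gramEntry_sub]
    congr 1
    simp only [blockSite]
    ring) k c

variable (P₀ : Measure ℝ) [IsProbabilityMeasure P₀]

theorem IsAdmissible.exists_ae_tendsto_sum_blocks (hψ : IsAdmissible ψ) {κ : ℝ}
    (hP : ∀ᵐ x ∂P₀, 0 ≤ x ∧ x ≤ κ) {L : ℕ} (hL : 0 < L) (k : ℕ) :
    ∃ l : ℝ, ∀ᵐ ϰ ∂(Measure.infinitePi fun _ : ℤ => P₀),
      Tendsto (fun N : ℕ => (∑ b ∈ windowBlocks L N,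
        ∑ i, gramEig (fun i : Fin L => weighted ψ ϰ (blockSite L i b)) i ^ k) / (2 * N + 1))
          atTop (𝓝 l) := by
  obtain ⟨R, hR, hb⟩ := exists_isBesselBound_of_isBoundedMatrix hψ.bounded
  set F : (Fin L → ℝ) → ℝ := weightedMoment (fun i : Fin L => ψ (blockSite L i 0)) k
  have hF : Measurable F := (continuous_weightedMoment _ k).measurable
  have hblock : ∀ (ϰ : ℤ → ℝ) (b : ℤ),
      ∑ i, gramEig (fun i : Fin L => weighted ψ ϰ (blockSite L i b)) i ^ k =
        F fun i => ϰ (blockSite L i b) := fun ϰ b =>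
    congrFun (hψ.weightedMoment_blockSite L k b) fun i => ϰ (blockSite L i b)
  have hint : Integrable F (Measure.infinitePi fun _ : Fin L => P₀) := by
    have hb₀ := hb.comp ((blockSite_injective L).comp (Prod.mk_left_injective (0 : ℤ)))
    refine Integrable.of_bound hF.aestronglyMeasurable (Fintype.card (Fin L) * (R * κ) ^ k) ?_
    filter_upwards [ae_infinitePi_forall P₀ hP] with y hy
    exact hb₀.abs_weightedMoment_le hR.le (fun i => (hy i).1) (fun i => (hy i).2) k
  have hsite : Function.Injective fun p : ℕ × Fin L =>
      blockSite L p.2 (Equiv.intEquivNat.symm p.1) :=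
    (blockSite_injective L).comp (Prod.swap_injective.comp
      (Equiv.intEquivNat.symm.injective.prodMap Function.injective_id))
  refine ⟨(L : ℝ)⁻¹ * ∫ y, F y ∂(Measure.infinitePi fun _ : Fin L => P₀), ?_⟩
  filter_upwards [ae_tendsto_average_blocks P₀ hsite hF hint] with ϰ hϰ
  have hnum : Tendsto (fun N : ℕ => 2 * (N / L)) atTop atTop :=
    (Nat.tendsto_div_const_atTop hL.ne').const_mul_atTop' two_pos
  refine ((tendsto_two_mul_div_div hL).mul (hϰ.comp hnum)).congr fun N => ?_
  simp only [hblock, Function.comp_apply, sum_Ico_neg_eq_sum_range]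
  rcases (2 * (N / L)).eq_zero_or_pos with h0 | h0
  · simp [h0]
  · field_simp

theorem IsAdmissible.exists_ae_eventually_abs_traceMoment_sub_le (hψ : IsAdmissible ψ) {κ : ℝ}
    (hP : ∀ᵐ x ∂P₀, 0 ≤ x ∧ x ≤ κ) {k : ℕ} (hk : k ≠ 0) {ε : ℝ} (hε : 0 < ε) :
    ∃ c : ℝ, ∀ᵐ ϰ ∂(Measure.infinitePi fun _ : ℤ => P₀),
      ∀ᶠ N in atTop, |traceMoment ψ ϰ N k - c| ≤ ε := by
  obtain ⟨R, hR, hb⟩ := exists_isBesselBound_of_isBoundedMatrix hψ.bounded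
  set h : ℤ → ℝ := fun d => κ ^ 2 * ‖gramEntry ψ d 0‖ ^ 2
  have hh : Summable h := hψ.summable_norm_gramEntry_sq.mul_left _
  set A : ℝ := k * (R * κ) ^ (k - 1)
  have hcoupling : Tendsto (fun L => A * √(interblockCoupling h L)) atTop (𝓝 0) := by
    simpa using
      (tendsto_interblockCoupling (fun d => by positivity) hh).sqrt.const_mul A
  obtain ⟨L, hLε, hL⟩ := ((hcoupling.eventually (gt_mem_nhds hε)).and
    (eventually_gt_atTop 0)).exists
  obtain ⟨l, hl⟩ := hψ.exists_ae_tendsto_sum_blocks P₀ hP hL k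
  refine ⟨l, ?_⟩
  filter_upwards [ae_infinitePi_forall P₀ hP, hl] with ϰ hϰ hblocks
  have hκ : 0 ≤ κ := (hϰ 0).1.trans (hϰ 0).2
  have hcompare := (hb.weighted hR.le (fun n => (hϰ n).1)
    fun n => (hϰ n).2).abs_sum_gramEig_window_pow_sub_sum_blocks_le (by positivity) hh
      (fun m n => (norm_inner_weighted_sq_le ψ (fun n => (hϰ n).1) (fun n => (hϰ n).2) m n).trans_eq
        (by rw [hψ.inner_eq_gramEntry_sub])) hL hk
  have herror : Tendsto (fun N : ℕ => A * (√(4 * L * (R * κ) ^ 2 / (2 * N + 1)) +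
      √(interblockCoupling h L)) + |(∑ b ∈ windowBlocks L N, ∑ i,
        gramEig (fun i : Fin L => weighted ψ ϰ (blockSite L i b)) i ^ k) / (2 * N + 1) - l|) atTop
      (𝓝 (A * √(interblockCoupling h L))) := by
    simpa using (((tendsto_const_div_two_mul_add_one (4 * L * (R * κ) ^ 2)).sqrt.add_const
      √(interblockCoupling h L)).const_mul A).add (hblocks.sub_const l).abs
  filter_upwards [herror.eventually (gt_mem_nhds hLε)] with N hN
  exact (abs_sub_le _ _ _).trans ((add_le_add_left (hcompare N) _).trans hN.le)

theorem IsAdmissible.exists_ae_tendsto_traceMoment (hψ : IsAdmissible ψ) {κ : ℝ}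
    (hP : ∀ᵐ x ∂P₀, 0 ≤ x ∧ x ≤ κ) {k : ℕ} (hk : k ≠ 0) :
    ∃ l : ℝ, ∀ᵐ ϰ ∂(Measure.infinitePi fun _ : ℤ => P₀),
      Tendsto (fun N => traceMoment ψ ϰ N k) atTop (𝓝 l) :=
  exists_ae_tendsto_of_ae_eventually_abs_sub_le fun _ hε =>
    hψ.exists_ae_eventually_abs_traceMoment_sub_le P₀ hP hk hε

end Moments

section WeakLimits

theorem ae_mem_of_isClosed_of_tendsto {X : Type*} [TopologicalSpace X] [MeasurableSpace X]
    [OpensMeasurableSpace X] [HasOuterApproxClosed X] {α : Type*} {l : Filter α} [l.NeBot]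
    {μ : α → ProbabilityMeasure X} {ν : ProbabilityMeasure X} (h : Tendsto μ l (𝓝 ν))
    {F : Set X} (hF : IsClosed F) (hμ : ∀ᶠ a in l, ∀ᵐ x ∂(μ a : Measure X), x ∈ F) :
    ∀ᵐ x ∂(ν : Measure X), x ∈ F := by
  have hzero : (fun a => (μ a : Measure X) Fᶜ) =ᶠ[l] fun _ => 0 := hμ
  have hle := ProbabilityMeasure.le_liminf_measure_open_of_tendsto h hF.isOpen_compl
  rw [liminf_congr hzero, liminf_const] at hle
  exact nonpos_iff_eq_zero.1 hle

theorem integrable_of_ae_mem_isCompact {X : Type*} [TopologicalSpace X] [MeasurableSpace X]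
    [OpensMeasurableSpace X] {μ : Measure X} [IsFiniteMeasure μ] {K : Set X} (hK : IsCompact K)
    (hμ : ∀ᵐ x ∂μ, x ∈ K) {f : X → ℝ} (hf : Continuous f) : Integrable f μ := by
  obtain ⟨C, hC⟩ := hK.exists_bound_of_continuousOn hf.continuousOn
  exact .of_bound hf.aestronglyMeasurable C (hμ.mono hC)

theorem abs_integral_sub_integral_le_of_ae {X : Type*} [MeasurableSpace X] {μ : Measure X}
    [IsProbabilityMeasure μ] {f g : X → ℝ} (hf : Integrable f μ) (hg : Integrable g μ) {ε : ℝ}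
    (h : ∀ᵐ x ∂μ, |f x - g x| ≤ ε) : |∫ x, f x ∂μ - ∫ x, g x ∂μ| ≤ ε := by
  rw [← integral_sub hf hg]
  simpa only [probReal_univ, mul_one, Real.norm_eq_abs] using
    norm_integral_le_of_norm_le_const (f := fun x => f x - g x) h

variable {α : Type*} {l : Filter α} {μ : α → Measure ℝ} [∀ a, IsProbabilityMeasure (μ a)]
  {ν : Measure ℝ} [IsProbabilityMeasure ν] {a b : ℝ}

theorem integral_polynomial_eval {m : Measure ℝ} (hm : ∀ k : ℕ, Integrable (fun x => x ^ k) m)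
    (p : Polynomial ℝ) :
    ∫ x, p.eval x ∂m = ∑ k ∈ Finset.range (p.natDegree + 1), p.coeff k * ∫ x, x ^ k ∂m := by
  simp_rw [Polynomial.eval_eq_sum_range]
  rw [integral_finsetSum _ fun k _ => (hm k).const_mul _]
  exact Finset.sum_congr rfl fun k _ => integral_const_mul _ _

theorem tendsto_integral_of_tendsto_moments (hμ : ∀ i, ∀ᵐ x ∂(μ i), x ∈ Set.Icc a b)
    (hν : ∀ᵐ x ∂ν, x ∈ Set.Icc a b)
    (h : ∀ k : ℕ, Tendsto (fun i => ∫ x, x ^ k ∂(μ i)) l (𝓝 (∫ x, x ^ k ∂ν)))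
    {f : ℝ → ℝ} (hf : Continuous f) :
    Tendsto (fun i => ∫ x, f x ∂(μ i)) l (𝓝 (∫ x, f x ∂ν)) := by
  refine Metric.tendsto_nhds.2 fun ε hε => ?_
  obtain ⟨p, hp⟩ := exists_polynomial_near_of_continuousOn a b f hf.continuousOn (ε / 3)
    (by positivity)
  have hnear : ∀ (m : Measure ℝ) [IsProbabilityMeasure m], (∀ᵐ x ∂m, x ∈ Set.Icc a b) →
      |∫ x, p.eval x ∂m - ∫ x, f x ∂m| ≤ ε / 3 := fun m _ hm =>
    abs_integral_sub_integral_le_of_ae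
      (integrable_of_ae_mem_isCompact isCompact_Icc hm p.continuous)
      (integrable_of_ae_mem_isCompact isCompact_Icc hm hf) (hm.mono fun x hx => (hp x hx).le)
  have hpoly : Tendsto (fun i => ∫ x, p.eval x ∂(μ i)) l (𝓝 (∫ x, p.eval x ∂ν)) := by
    have hpow : ∀ (m : Measure ℝ) [IsProbabilityMeasure m], (∀ᵐ x ∂m, x ∈ Set.Icc a b) →
        ∀ k : ℕ, Integrable (fun x => x ^ k) m := fun m _ hm k =>
      integrable_of_ae_mem_isCompact isCompact_Icc hm (continuous_pow k)
    simp only [integral_polynomial_eval (hpow _ (hμ _)), integral_polynomial_eval (hpow ν hν)]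
    exact tendsto_finsetSum _ fun k _ => (h k).const_mul _
  filter_upwards [Metric.tendsto_nhds.1 hpoly (ε / 3) (by positivity)] with i hi
  rw [Real.dist_eq, abs_lt] at hi ⊢
  have hμi := abs_le.1 (hnear (μ i) (hμ i))
  have hνp := abs_le.1 (hnear ν hν)
  constructor <;> linarith

theorem tendsto_integral_of_tendsto_of_ae_mem_Icc {μ : α → ProbabilityMeasure ℝ}
    {ν : ProbabilityMeasure ℝ} (h : Tendsto μ l (𝓝 ν))
    (hμ : ∀ i, ∀ᵐ x ∂(μ i : Measure ℝ), x ∈ Set.Icc a b)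
    (hν : ∀ᵐ x ∂(ν : Measure ℝ), x ∈ Set.Icc a b) {f : ℝ → ℝ} (hf : Continuous f) :
    Tendsto (fun i => ∫ x, f x ∂(μ i : Measure ℝ)) l (𝓝 (∫ x, f x ∂(ν : Measure ℝ))) := by
  obtain ⟨x₀, hx₀⟩ := hν.exists
  have hab : a ≤ b := hx₀.1.trans hx₀.2
  obtain ⟨C, hC⟩ := isCompact_univ.exists_bound_of_continuousOn
    (hf.comp continuous_subtype_val : Continuous fun x : Set.Icc a b => f x).continuousOn
  let g : ℝ →ᵇ ℝ := .ofNormedAddCommGroup (Set.IccExtend hab fun x => f x)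
    (hf.comp continuous_subtype_val).Icc_extend' C fun _ => hC _ (Set.mem_univ _)
  have hg : ∀ m : Measure ℝ, (∀ᵐ x ∂m, x ∈ Set.Icc a b) → ∫ x, g x ∂m = ∫ x, f x ∂m :=
    fun m hm => integral_congr_ae (hm.mono fun x hx => Set.IccExtend_of_mem hab (fun x => f x) hx)
  have hlim := (ProbabilityMeasure.tendsto_iff_forall_integral_tendsto.1 h) g
  simpa only [hg _ (hμ _), hg _ hν] using hlim

theorem exists_probabilityMeasure_of_tendsto_moments [l.NeBot]
    (hμ : ∀ i, ∀ᵐ x ∂(μ i), x ∈ Set.Icc a b) {m : ℕ → ℝ}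
    (h : ∀ k : ℕ, Tendsto (fun i => ∫ x, x ^ k ∂(μ i)) l (𝓝 (m k))) :
    ∃ ν : ProbabilityMeasure ℝ, (∀ᵐ x ∂(ν : Measure ℝ), x ∈ Set.Icc a b) ∧
      ∀ k, ∫ x, x ^ k ∂(ν : Measure ℝ) = m k := by
  set P : α → ProbabilityMeasure ℝ := fun i => ⟨μ i, inferInstance⟩
  have htight : IsTightMeasureSet {(m : Measure ℝ) | m ∈ Set.range P} := by
    rw [isTightMeasureSet_iff_exists_isCompact_measure_compl_le]
    rintro ε -
    refine ⟨Set.Icc a b, isCompact_Icc, ?_⟩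
    rintro _ ⟨_, ⟨i, rfl⟩, rfl⟩
    exact (ae_iff.1 (hμ i)).trans_le zero_le
  obtain ⟨ν, -, hν⟩ := (isCompact_closure_of_isTightMeasureSet htight).exists_mapClusterPt
    (f := l) (u := P) (tendsto_principal.2 (.of_forall fun i => subset_closure ⟨i, rfl⟩))
  obtain ⟨U, hU, hUν⟩ := mapClusterPt_iff_ultrafilter.1 hν
  have hsupp := ae_mem_of_isClosed_of_tendsto hUν isClosed_Icc (.of_forall hμ)
  exact ⟨ν, hsupp, fun k => tendsto_nhds_unique
    (tendsto_integral_of_tendsto_of_ae_mem_Icc hUν hμ hsupp (continuous_pow k))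
    ((h k).mono_left hU)⟩

end WeakLimits

section Existence

variable {H : Type*} [NormedAddCommGroup H] [InnerProductSpace ℂ H] {ψ : ℤ → H}

theorem IsAdmissible.truncatedEig_pos (hψ : IsAdmissible ψ) {ϰ : ℤ → ℝ} (hϰ : ∀ n, 0 < ϰ n) (N : ℕ)
    (i : Finset.Icc (-(N : ℤ)) N) : 0 < truncatedEig ψ ϰ N i :=
  gramEig_pos ((linearIndependent_weighted hψ.linearIndependent hϰ).comp _
    Subtype.val_injective) i

theorem truncatedEig_le {R κ : ℝ} (hR : 0 ≤ R) (hb : IsBesselBound ψ R) {ϰ : ℤ → ℝ}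
    (hϰ : ∀ n, 0 ≤ ϰ n) (hκ : ∀ n, ϰ n ≤ κ) (N : ℕ) (i : Finset.Icc (-(N : ℤ)) N) :
    truncatedEig ψ ϰ N i ≤ R * κ :=
  gramEig_le ((hb.weighted hR hϰ hκ).comp Subtype.val_injective) i

theorem IsAdmissible.countingMeasure_eq (hψ : IsAdmissible ψ) {ϰ : ℤ → ℝ} (hϰ : ∀ n, 0 < ϰ n)
    (N : ℕ) : countingMeasure ψ ϰ N =
      ((2 * N + 1 : ℕ) : ℝ≥0∞)⁻¹ • ∑ i, Measure.dirac (truncatedEig ψ ϰ N i) := by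
  rw [countingMeasure, truncated_eq_frameOp ψ fun n => (hϰ n).le,
    sum_finrank_eigenspace_frameOp_dirac]
  congr 1
  exact Finset.sum_congr rfl fun i _ => if_neg (hψ.truncatedEig_pos hϰ N i).ne'

theorem IsAdmissible.integral_countingMeasure (hψ : IsAdmissible ψ) {ϰ : ℤ → ℝ}
    (hϰ : ∀ n, 0 < ϰ n) (N : ℕ) (f : ℝ → ℝ) :
    ∫ x, f x ∂(countingMeasure ψ ϰ N) = (∑ i, f (truncatedEig ψ ϰ N i)) / (2 * N + 1) := by
  rw [hψ.countingMeasure_eq hϰ, integral_smul_measure, integral_finsetSum_measure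
    fun i _ => integrable_dirac enorm_lt_top, ENNReal.toReal_inv, ENNReal.toReal_natCast,
    smul_eq_mul, ← div_eq_inv_mul]
  push_cast
  simp_rw [integral_dirac]

theorem IsAdmissible.isProbabilityMeasure_countingMeasure (hψ : IsAdmissible ψ) {ϰ : ℤ → ℝ}
    (hϰ : ∀ n, 0 < ϰ n) (N : ℕ) : IsProbabilityMeasure (countingMeasure ψ ϰ N) := by
  refine ⟨?_⟩
  rw [hψ.countingMeasure_eq hϰ, Measure.smul_apply, Measure.finsetSum_apply]
  simp only [measure_univ, Finset.sum_const, Finset.card_univ, Fintype.card_coe,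
    card_Icc_neg_self, nsmul_eq_mul, mul_one, smul_eq_mul]
  exact ENNReal.inv_mul_cancel (Nat.cast_ne_zero.2 (Nat.succ_ne_zero _)) (ENNReal.natCast_ne_top _)

theorem IsAdmissible.ae_countingMeasure (hψ : IsAdmissible ψ) {ϰ : ℤ → ℝ} (hϰ : ∀ n, 0 < ϰ n)
    {N : ℕ} {p : ℝ → Prop} (hp : ∀ i, p (truncatedEig ψ ϰ N i)) :
    ∀ᵐ x ∂(countingMeasure ψ ϰ N), p x := by
  rw [hψ.countingMeasure_eq hϰ, ← Measure.sum_fintype]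
  refine Measure.ae_smul_measure (Measure.ae_sum_iff.2 fun i => ?_) _
  rw [ae_dirac_eq]
  exact hp i

theorem IsAdmissible.exists_ae_tendsto_moments (hψ : IsAdmissible ψ) (P₀ : Measure ℝ)
    [IsProbabilityMeasure P₀] {κ : ℝ} (hP : ∀ᵐ x ∂P₀, 0 < x ∧ x ≤ κ) (k : ℕ) :
    ∃ l : ℝ, ∀ᵐ ϰ ∂(Measure.infinitePi fun _ : ℤ => P₀),
      Tendsto (fun N => ∫ x, x ^ k ∂(countingMeasure ψ ϰ N)) atTop (𝓝 l) := by
  rcases eq_or_ne k 0 with rfl | hk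
  · refine ⟨1, (ae_infinitePi_forall P₀ hP).mono fun ϰ hϰ => ?_⟩
    have hprob := hψ.isProbabilityMeasure_countingMeasure fun n => (hϰ n).1
    simp only [pow_zero, integral_const, probReal_univ, smul_eq_mul, mul_one, tendsto_const_nhds]
  · obtain ⟨l, hl⟩ := hψ.exists_ae_tendsto_traceMoment P₀ (hP.mono fun x hx => ⟨hx.1.le, hx.2⟩) hk
    refine ⟨l, ((ae_infinitePi_forall P₀ hP).and hl).mono fun ϰ hϰ => hϰ.2.congr fun N => ?_⟩
    exact (hψ.integral_countingMeasure (fun n => (hϰ.1 n).1) N fun x => x ^ k).symm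

theorem IsAdmissible.exists_isIDSMeasure (hψ : IsAdmissible ψ) (P₀ : Measure ℝ)
    [IsProbabilityMeasure P₀] {κ : ℝ} (hP : ∀ᵐ x ∂P₀, 0 < x ∧ x ≤ κ) :
    ∃ ν : Measure ℝ, IsIDSMeasure ψ P₀ ν := by
  obtain ⟨R, hR, hb⟩ := exists_isBesselBound_of_isBoundedMatrix hψ.bounded
  choose m hm using hψ.exists_ae_tendsto_moments P₀ hP
  have hprob : ∀ ϰ : ℤ → ℝ, (∀ n, 0 < ϰ n ∧ ϰ n ≤ κ) → ∀ N,
      IsProbabilityMeasure (countingMeasure ψ ϰ N) := fun ϰ hϰ =>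
    hψ.isProbabilityMeasure_countingMeasure fun n => (hϰ n).1
  have hsupp : ∀ ϰ : ℤ → ℝ, (∀ n, 0 < ϰ n ∧ ϰ n ≤ κ) → ∀ N,
      ∀ᵐ x ∂(countingMeasure ψ ϰ N), x ∈ Set.Icc 0 (R * κ) := fun ϰ hϰ N =>
    hψ.ae_countingMeasure (fun n => (hϰ n).1) fun i =>
      ⟨(hψ.truncatedEig_pos (fun n => (hϰ n).1) N i).le,
        truncatedEig_le hR.le hb (fun n => (hϰ n).1.le) (fun n => (hϰ n).2) N i⟩
  have hall := (ae_infinitePi_forall P₀ hP).and (ae_all_iff.2 hm)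
  obtain ⟨ϰ₀, hϰ₀, hm₀⟩ := hall.exists
  have hprob₀ := hprob ϰ₀ hϰ₀
  obtain ⟨ν, hνsupp, hνm⟩ := exists_probabilityMeasure_of_tendsto_moments (hsupp ϰ₀ hϰ₀) hm₀
  refine ⟨ν, inferInstance, hall.mono fun ϰ hϰ f => ?_⟩
  have hprobϰ := hprob ϰ hϰ.1
  exact tendsto_integral_of_tendsto_moments (hsupp ϰ hϰ.1) hνsupp
    (fun k => (hνm k).symm ▸ hϰ.2 k) f.continuous

end Existence

section SpectralAveraging

open ProbabilityTheory
open scoped NNReal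

theorem im_div_one_add_mul (w : ℂ) (t : ℝ) :
    (w / (1 + t * w)).im = w.im / Complex.normSq (1 + t * w) := by
  rw [Complex.div_im, ← sub_div]
  simp only [Complex.add_re, Complex.one_re, Complex.add_im, Complex.one_im, Complex.re_ofReal_mul,
    Complex.im_ofReal_mul]
  ring

theorem im_div_one_add_mul_eq_cauchyPDFReal {w : ℂ} (hw : 0 < w.im) (t : ℝ) :
    (w / (1 + t * w)).im = Real.pi * cauchyPDFReal (-(w.re / Complex.normSq w))
      (w.im / Complex.normSq w).toNNReal t := by
  have hnormSq : 0 < Complex.normSq w := Complex.normSq_pos.2 fun h => by simp [h] at hw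
  have hfactor : Complex.normSq (1 + t * w) = Complex.normSq w *
      ((t + w.re / Complex.normSq w) ^ 2 + (w.im / Complex.normSq w) ^ 2) := by
    field_simp
    simp only [Complex.normSq_apply, Complex.add_re, Complex.one_re, Complex.add_im,
      Complex.one_im, Complex.re_ofReal_mul, Complex.im_ofReal_mul]
    ring
  rw [im_div_one_add_mul, hfactor, cauchyPDFReal_def, Real.coe_toNNReal _ (by positivity),
    sub_neg_eq_add]
  have := Real.pi_pos
  field_simp

theorem lintegral_mul_im_div_one_add_mul_le {P : Measure ℝ} {c : ℝ≥0∞} (hP : P ≤ c • volume)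
    {κ : ℝ} (hκ : ∀ᵐ t ∂P, 0 ≤ t ∧ t ≤ κ) {w : ℂ} (hw : 0 < w.im) :
    ∫⁻ t, ENNReal.ofReal (t * (Real.pi⁻¹ * (w / (1 + t * w)).im)) ∂P ≤ ENNReal.ofReal κ * c := by
  set x₀ := -(w.re / Complex.normSq w)
  set γ := (w.im / Complex.normSq w).toNNReal
  have hγ0 : γ ≠ 0 := (Real.toNNReal_pos.2 (div_pos hw (Complex.normSq_pos.2 fun h => by
    simp [h] at hw))).ne'
  calc ∫⁻ t, ENNReal.ofReal (t * (Real.pi⁻¹ * (w / (1 + t * w)).im)) ∂P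
      ≤ ∫⁻ t, ENNReal.ofReal κ * cauchyPDF x₀ γ t ∂P := by
        refine lintegral_mono_ae ?_
        filter_upwards [hκ] with t ht
        rw [im_div_one_add_mul_eq_cauchyPDFReal hw, inv_mul_cancel_left₀ Real.pi_ne_zero,
          ENNReal.ofReal_mul ht.1, cauchyPDF]
        gcongr
        exact ht.2
    _ ≤ ∫⁻ t, ENNReal.ofReal κ * cauchyPDF x₀ γ t ∂(c • volume) := lintegral_mono' hP le_rfl
    _ = ENNReal.ofReal κ * c := by
        rw [lintegral_const_mul _ (by fun_prop), lintegral_smul_measure,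
          lintegral_cauchyPDF_eq_one _ hγ0, smul_eq_mul, mul_one]

theorem withDensity_ofReal_le_smul {X : Type*} [MeasurableSpace X] {μ : Measure X} {ρ : X → ℝ}
    {C : ℝ} (hρ : ∀ᵐ x ∂μ, ρ x ≤ C) :
    μ.withDensity (fun x => ENNReal.ofReal (ρ x)) ≤ ENNReal.ofReal C • μ := by
  rw [← withDensity_const]
  exact withDensity_mono (hρ.mono fun x hx => ENNReal.ofReal_le_ofReal hx)

theorem map_update_prod_infinitePi {ι : Type*} [DecidableEq ι] {X : ι → Type*}
    [∀ i, MeasurableSpace (X i)] (μ : ∀ i, Measure (X i)) [∀ i, IsProbabilityMeasure (μ i)]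
    (n : ι) :
    ((μ n).prod (Measure.infinitePi μ)).map (fun p => Function.update p.2 n p.1) =
      Measure.infinitePi μ := by
  have hmeas : Measurable fun p : X n × (∀ i, X i) => Function.update p.2 n p.1 :=
    measurable_update'.comp measurable_swap
  refine Measure.eq_infinitePi μ fun s t ht => ?_
  rw [Measure.map_apply hmeas (.pi s.countable_toSet fun i _ => ht i)]
  have hpre : (fun p : X n × (∀ i, X i) => Function.update p.2 n p.1) ⁻¹' (s : Set ι).pi t =
      {x | n ∈ s → x ∈ t n} ×ˢ (s.erase n : Set ι).pi t := by
    ext p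
    simp only [Set.mem_preimage, Set.mem_pi, Finset.mem_coe, Set.mem_prod, Finset.mem_erase,
      Set.mem_ofPred_eq]
    refine ⟨fun h => ⟨fun hn => by simpa using h n hn, fun i hi => by
      simpa [hi.1] using h i hi.2⟩, fun h i hi => ?_⟩
    rcases eq_or_ne i n with rfl | hne
    · simpa using h.1 hi
    · simpa [hne] using h.2 i ⟨hne, hi⟩
  rw [hpre, Measure.prod_prod, Measure.infinitePi_pi _ (fun i _ => ht i)]
  by_cases hn : n ∈ s
  · simp only [hn, forall_const, Set.ofPred_mem_eq, Finset.mul_prod_erase s (fun i => μ i (t i)) hn]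
  · simp [hn]

end SpectralAveraging

section BorelTransform

variable {H : Type*} [NormedAddCommGroup H] [InnerProductSpace ℂ H] [CompleteSpace H]
  {A : H →L[ℂ] H} {z : ℂ}

theorem mem_resolventSet_of_isSelfAdjoint (hA : IsSelfAdjoint A) (hz : z.im ≠ 0) :
    z ∈ resolventSet ℂ A :=
  spectrum.notMem_iff.1 fun h => hz (hA.im_eq_zero_of_mem_spectrum h)

theorem resolvent_apply_sub (hA : IsSelfAdjoint A) (hz : z.im ≠ 0) (x : H) :
    resolvent A z (z • x - A x) = x := by
  simpa [resolvent, Algebra.algebraMap_eq_smul_one] using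
    DFunLike.congr_fun (Ring.inverse_mul_cancel _ (mem_resolventSet_of_isSelfAdjoint hA hz)) x

theorem sub_resolvent_apply (hA : IsSelfAdjoint A) (hz : z.im ≠ 0) (x : H) :
    z • resolvent A z x - A (resolvent A z x) = x := by
  simpa [resolvent, Algebra.algebraMap_eq_smul_one] using
    DFunLike.congr_fun (Ring.mul_inverse_cancel _ (mem_resolventSet_of_isSelfAdjoint hA hz)) x

/-- The Borel transform `⟨x, (A - z)⁻¹ x⟩` of the spectral measure of `A` at the vector `x`.
The sign is opposite to that of `resolvent A z = (z - A)⁻¹`, so that the upper half-plane is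
mapped to itself. -/
noncomputable def borelTransform (A : H →L[ℂ] H) (x : H) (z : ℂ) : ℂ :=
  -inner ℂ x (resolvent A z x)

theorem borelTransform_im_pos (hA : IsSelfAdjoint A) (hz : 0 < z.im) {x : H} (hx : x ≠ 0) :
    0 < (borelTransform A x z).im := by
  set y := resolvent A z x with hy
  have hxy : z • y - A y = x := sub_resolvent_apply hA hz.ne' x
  have hy0 : y ≠ 0 := fun h => hx (by simpa [h] using hxy.symm)
  have him : (inner ℂ (A y) y).im = 0 := by
    rw [← Complex.conj_eq_iff_im, inner_conj_symm]
    exact (ContinuousLinearMap.isSelfAdjoint_iff_isSymmetric.1 hA y y).symm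
  have hinner : inner ℂ x y = starRingEnd ℂ z * inner ℂ y y - inner ℂ (A y) y := by
    rw [← hxy, inner_sub_left, inner_smul_left]
  have hself : inner ℂ y y = ((‖y‖ ^ 2 : ℝ) : ℂ) := by
    rw [inner_self_eq_norm_sq_to_K, Complex.ofReal_pow]
    rfl
  have hnorm : 0 < ‖y‖ := norm_pos_iff.2 hy0
  rw [borelTransform, ← hy, hinner, Complex.neg_im, Complex.sub_im, him,
    hself, Complex.im_mul_ofReal, Complex.conj_im]
  simpa using mul_pos hz (pow_pos hnorm 2)

theorem isSelfAdjoint_smul_rankOne (t : ℝ) (x : H) :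
    IsSelfAdjoint ((t : ℂ) • InnerProductSpace.rankOne ℂ x x) :=
  .smul (Complex.conj_ofReal t) (InnerProductSpace.adjoint_rankOne x x)

theorem borelTransform_add_smul_rankOne (hA : IsSelfAdjoint A) (hz : 0 < z.im) {x : H}
    (hx : x ≠ 0) (t : ℝ) :
    borelTransform (A + (t : ℂ) • InnerProductSpace.rankOne ℂ x x) x z =
      borelTransform A x z / (1 + t * borelTransform A x z) := by
  set F := borelTransform A x z with hF
  set B := A + (t : ℂ) • InnerProductSpace.rankOne ℂ x x with hB
  have hBsa : IsSelfAdjoint B := hA.add (isSelfAdjoint_smul_rankOne t x)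
  have hres : z • resolvent A z x - B (resolvent A z x) = (1 + t * F) • x := by
    rw [hF, borelTransform, hB]
    simp only [add_apply, smul_apply, InnerProductSpace.rankOne_apply]
    rw [← sub_sub, sub_resolvent_apply hA hz.ne', smul_smul]
    module
  have hmul : F = (1 + t * F) * borelTransform B x z := by
    rw [borelTransform, ← neg_mul_eq_mul_neg, ← inner_smul_right, ← map_smul, ← hres,
      resolvent_apply_sub hBsa hz.ne', hF, borelTransform]
  have hne : 1 + (t : ℂ) * F ≠ 0 := fun h => (borelTransform_im_pos hA hz hx).ne' <| by
    rw [← hF, hmul, h, zero_mul, Complex.zero_im]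
  rw [eq_div_iff hne, mul_comm, ← hmul]

theorem continuous_borelTransform {α : Type*} [TopologicalSpace α] {A : α → H →L[ℂ] H}
    (hA : Continuous A) (hs : ∀ a, IsSelfAdjoint (A a)) (hz : z.im ≠ 0) (x : H) :
    Continuous fun a => borelTransform (A a) x z := by
  have hres : Continuous fun a => resolvent (A a) z := continuous_iff_continuousAt.2 fun a => by
    obtain ⟨u, hu⟩ := mem_resolventSet_of_isSelfAdjoint (hs a) hz
    have hinv := NormedRing.inverse_continuousAt u
    rw [hu] at hinv
    exact ContinuousAt.comp (f := fun a => algebraMap ℂ (H →L[ℂ] H) z - A a) hinv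
      (continuous_const.sub hA).continuousAt
  exact (continuous_const.inner (hres.clm_apply continuous_const)).neg

end BorelTransform

section Wegner

open ProbabilityTheory
open scoped NNReal

theorem ofReal_le_of_ae_tendsto_of_lintegral_le {Ω : Type*} [MeasurableSpace Ω] {μ : Measure Ω}
    [IsProbabilityMeasure μ] {g : ℕ → Ω → ℝ} {a : ℝ} {C : ℝ≥0∞} (hg : ∀ N, AEMeasurable (g N) μ)
    (hlim : ∀ᵐ ω ∂μ, Tendsto (fun N => g N ω) atTop (𝓝 a))
    (hC : ∀ N, ∫⁻ ω, ENNReal.ofReal (g N ω) ∂μ ≤ C) : ENNReal.ofReal a ≤ C := by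
  calc ENNReal.ofReal a = ∫⁻ _ω, ENNReal.ofReal a ∂μ := by simp
    _ = ∫⁻ ω, liminf (fun N => ENNReal.ofReal (g N ω)) atTop ∂μ :=
        lintegral_congr_ae <| hlim.mono fun ω hω => (ENNReal.tendsto_ofReal hω).liminf_eq.symm
    _ ≤ liminf (fun N => ∫⁻ ω, ENNReal.ofReal (g N ω) ∂μ) atTop :=
        lintegral_liminf_le' fun N => (hg N).ennreal_ofReal
    _ ≤ liminf (fun _ : ℕ => C) atTop := liminf_le_liminf (.of_forall hC)
    _ = C := liminf_const C

theorem im_div_sub_eq_cauchyPDFReal (x t : ℝ) {γ : ℝ≥0} (hγ : γ ≠ 0) :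
    ((t : ℂ) / (t - ⟨x, γ⟩)).im = Real.pi * (t * cauchyPDFReal x γ t) := by
  have hden : Complex.normSq ((t : ℂ) - ⟨x, γ⟩) = (t - x) ^ 2 + γ ^ 2 := by
    simp only [Complex.normSq_apply, Complex.sub_re, Complex.ofReal_re, Complex.sub_im,
      Complex.ofReal_im]
    ring
  have : (0 : ℝ) < (t - x) ^ 2 + γ ^ 2 := by positivity
  rw [Complex.div_im, hden, cauchyPDFReal_def]
  simp only [Complex.ofReal_im, Complex.sub_im, Complex.ofReal_re]
  have := Real.pi_pos
  field_simp
  ring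

theorem continuous_cauchyPDFReal (x : ℝ) {γ : ℝ≥0} (hγ : γ ≠ 0) :
    Continuous (cauchyPDFReal x γ) := by
  unfold cauchyPDFReal
  exact continuous_const.mul (Continuous.inv₀ (by fun_prop) fun t => by positivity)

theorem exists_abs_mul_cauchyPDFReal_le (x : ℝ) {γ : ℝ≥0} (hγ : γ ≠ 0) :
    ∃ C, ∀ t, |t * cauchyPDFReal x γ t| ≤ C := by
  set z : ℂ := ⟨x, γ⟩ with hz
  refine ⟨Real.pi⁻¹ * (1 + ‖z‖ / γ), fun t => ?_⟩
  have hγz : (γ : ℝ) ≤ ‖(t : ℂ) - z‖ := by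
    simpa [hz] using Complex.abs_im_le_norm ((t : ℂ) - z)
  have hγ' : (0 : ℝ) < γ := by positivity
  have hne : (t : ℂ) - z ≠ 0 := norm_pos_iff.1 (hγ'.trans_le hγz)
  have hbound : Real.pi * |t * cauchyPDFReal x γ t| ≤ 1 + ‖z‖ / γ := calc
    Real.pi * |t * cauchyPDFReal x γ t| = |((t : ℂ) / (t - z)).im| := by
        rw [hz, im_div_sub_eq_cauchyPDFReal x t hγ, abs_mul _ (_ * _), abs_of_pos Real.pi_pos]
    _ ≤ ‖(t : ℂ) / (t - z)‖ := Complex.abs_im_le_norm _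
    _ = ‖1 + z / (t - z)‖ := by rw [one_add_div hne, sub_add_cancel]
    _ ≤ 1 + ‖z‖ / ‖(t : ℂ) - z‖ := by simpa using norm_add_le (1 : ℂ) (z / (t - z))
    _ ≤ 1 + ‖z‖ / γ := by gcongr
  rwa [← le_inv_mul_iff₀ Real.pi_pos] at hbound

variable {H : Type*} [NormedAddCommGroup H] [InnerProductSpace ℂ H] {ψ : ℤ → H}

theorem truncated_update (ψ : ℤ → H) (ϰ : ℤ → ℝ) {N : ℕ} {n : ℤ}
    (hn : n ∈ Finset.Icc (-(N : ℤ)) N) (t : ℝ) :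
    truncated ψ (Function.update ϰ n t) N =
      truncated ψ (Function.update ϰ n 0) N +
        (t : ℂ) • InnerProductSpace.rankOne ℂ (ψ n) (ψ n) := by
  have hsplit : ∀ s : ℝ, truncated ψ (Function.update ϰ n s) N =
      ∑ i ∈ (Finset.Icc (-(N : ℤ)) N).erase n,
        (ϰ i : ℂ) • InnerProductSpace.rankOne ℂ (ψ i) (ψ i) +
      (s : ℂ) • InnerProductSpace.rankOne ℂ (ψ n) (ψ n) := fun s => by
    rw [truncated, ← Finset.sum_erase_add _ _ hn, Function.update_self]
    congr 1
    refine Finset.sum_congr rfl fun i hi => ?_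
    rw [Function.update_of_ne (Finset.ne_of_mem_erase hi)]
  rw [hsplit t, hsplit 0, Complex.ofReal_zero, zero_smul, add_zero]

theorem continuous_truncated (ψ : ℤ → H) (N : ℕ) : Continuous fun ϰ => truncated ψ ϰ N := by
  unfold truncated
  fun_prop

theorem IsAdmissible.ne_zero (hψ : IsAdmissible ψ) (n : ℤ) : ψ n ≠ 0 :=
  norm_ne_zero_iff.1 (by simp [hψ.norm_eq_one n])

theorem IsAdmissible.ae_nonneg_of_isIDSMeasure (hψ : IsAdmissible ψ) {P₀ : Measure ℝ}
    [IsProbabilityMeasure P₀] (hP : ∀ᵐ t ∂P₀, 0 < t) {ν : Measure ℝ} (hν : IsIDSMeasure ψ P₀ ν) :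
    ∀ᵐ t ∂ν, 0 ≤ t := by
  obtain ⟨ϰ, hconv, hϰ⟩ := (hν.tendsto.and (ae_infinitePi_forall P₀ hP)).exists
  have hlim : Tendsto (β := ProbabilityMeasure ℝ)
      (fun N => ⟨countingMeasure ψ ϰ N, hψ.isProbabilityMeasure_countingMeasure hϰ N⟩) atTop
      (𝓝 ⟨ν, hν.isProbabilityMeasure⟩) :=
    ProbabilityMeasure.tendsto_iff_forall_integral_tendsto.2 hconv
  exact ae_mem_of_isClosed_of_tendsto hlim isClosed_Ici <| .of_forall fun N =>
    hψ.ae_countingMeasure hϰ fun i => (hψ.truncatedEig_pos hϰ N i).le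

variable [CompleteSpace H]

theorem isSelfAdjoint_truncated (ψ : ℤ → H) (ϰ : ℤ → ℝ) (N : ℕ) :
    IsSelfAdjoint (truncated ψ ϰ N) :=
  isSelfAdjoint_sum _ fun i _ => isSelfAdjoint_smul_rankOne (ϰ i) (ψ i)

/-- The local density of states of the truncated operator at the site `n`, weighted by the
coupling `ϰ n` and smoothed by the Cauchy distribution of location `z.re` and scale `z.im`. Its sum
over the sites is the sum of `t * cauchyPDFReal z.re z.im t` over the eigenvalues `t`. -/
noncomputable def localDensity (ψ : ℤ → H) (z : ℂ) (N : ℕ) (n : ℤ) (ϰ : ℤ → ℝ) : ℝ :=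
  ϰ n * (Real.pi⁻¹ * (borelTransform (truncated ψ ϰ N) (ψ n) z).im)

theorem measurable_localDensity (ψ : ℤ → H) {z : ℂ} (hz : z.im ≠ 0) (N : ℕ) (n : ℤ) :
    Measurable (localDensity ψ z N n) := by
  have hborel := continuous_borelTransform (continuous_truncated ψ N)
    (fun ϰ => isSelfAdjoint_truncated ψ ϰ N) hz (ψ n)
  exact ((continuous_apply n).mul
    (continuous_const.mul (Complex.continuous_im.comp hborel))).measurable

theorem IsAdmissible.localDensity_nonneg (hψ : IsAdmissible ψ) {z : ℂ} (hz : 0 < z.im) (N : ℕ)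
    {n : ℤ} {ϰ : ℤ → ℝ} (hϰ : 0 ≤ ϰ n) : 0 ≤ localDensity ψ z N n ϰ :=
  mul_nonneg hϰ <| mul_nonneg (by positivity)
    (borelTransform_im_pos (isSelfAdjoint_truncated ψ ϰ N) hz (hψ.ne_zero n)).le

theorem IsAdmissible.localDensity_update (hψ : IsAdmissible ψ) {z : ℂ} (hz : 0 < z.im) {N : ℕ}
    {n : ℤ} (hn : n ∈ Finset.Icc (-(N : ℤ)) N) (ϰ : ℤ → ℝ) (t : ℝ) :
    localDensity ψ z N n (Function.update ϰ n t) = t * (Real.pi⁻¹ *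
      (borelTransform (truncated ψ (Function.update ϰ n 0) N) (ψ n) z /
        (1 + t * borelTransform (truncated ψ (Function.update ϰ n 0) N) (ψ n) z)).im) := by
  rw [localDensity, Function.update_self, truncated_update ψ ϰ hn, borelTransform_add_smul_rankOne
    (isSelfAdjoint_truncated ψ _ N) hz (hψ.ne_zero n)]

theorem sum_truncatedEig_mul_cauchyPDFReal (ψ : ℤ → H) {ϰ : ℤ → ℝ} (hϰ : ∀ n, 0 ≤ ϰ n) (N : ℕ)
    (x : ℝ) {γ : ℝ≥0} (hγ : γ ≠ 0) :
    ∑ i, truncatedEig ψ ϰ N i * cauchyPDFReal x γ (truncatedEig ψ ϰ N i) =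
      ∑ n ∈ Finset.Icc (-(N : ℤ)) N, localDensity ψ ⟨x, γ⟩ N n ϰ := by
  set z : ℂ := ⟨x, γ⟩ with hz
  have hzim : z.im ≠ 0 := by simpa [hz] using hγ
  have htrace := sum_inner_resolvent (fun n : Finset.Icc (-(N : ℤ)) N => weighted ψ ϰ n) hzim
    (-resolvent (truncated ψ ϰ N) z) fun y => by
      rw [← truncated_eq_frameOp ψ hϰ, neg_apply, ← map_neg, neg_sub]
      exact resolvent_apply_sub (isSelfAdjoint_truncated ψ ϰ N) hzim y
  refine mul_left_cancel₀ Real.pi_ne_zero ?_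
  calc Real.pi * ∑ i, truncatedEig ψ ϰ N i * cauchyPDFReal x γ (truncatedEig ψ ϰ N i)
      = (∑ i, (truncatedEig ψ ϰ N i : ℂ) / (truncatedEig ψ ϰ N i - z)).im := by
        simp only [Finset.mul_sum, Complex.im_sum, hz, im_div_sub_eq_cauchyPDFReal x _ hγ]
    _ = ∑ n : Finset.Icc (-(N : ℤ)) N,
          ϰ n * (borelTransform (truncated ψ ϰ N) (ψ n) z).im := by
        unfold truncatedEig
        rw [← htrace, Complex.im_sum]
        refine Finset.sum_congr rfl fun n _ => ?_
        rw [weighted, map_smul, inner_smul_left, inner_smul_right, Complex.conj_ofReal,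
          ← mul_assoc, ← Complex.ofReal_mul, Real.mul_self_sqrt (hϰ n), Complex.im_ofReal_mul,
          neg_apply, inner_neg_right, borelTransform]
    _ = Real.pi * ∑ n ∈ Finset.Icc (-(N : ℤ)) N, localDensity ψ z N n ϰ := by
        rw [Finset.sum_coe_sort _ fun n : ℤ => ϰ n * (borelTransform (truncated ψ ϰ N) (ψ n) z).im,
          Finset.mul_sum]
        refine Finset.sum_congr rfl fun n _ => ?_
        rw [localDensity, mul_left_comm, mul_inv_cancel_left₀ Real.pi_ne_zero]

variable {P₀ : Measure ℝ} [IsProbabilityMeasure P₀] {c : ℝ≥0∞} {κ : ℝ}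

theorem IsAdmissible.lintegral_localDensity_le (hψ : IsAdmissible ψ) (hP : P₀ ≤ c • volume)
    (hκ : ∀ᵐ t ∂P₀, 0 ≤ t ∧ t ≤ κ) {z : ℂ} (hz : 0 < z.im) {N : ℕ} {n : ℤ}
    (hn : n ∈ Finset.Icc (-(N : ℤ)) N) :
    ∫⁻ ϰ, ENNReal.ofReal (localDensity ψ z N n ϰ) ∂(Measure.infinitePi fun _ : ℤ => P₀) ≤
      ENNReal.ofReal κ * c := by
  have hupdate : Measurable fun p : ℝ × (ℤ → ℝ) => Function.update p.2 n p.1 :=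
    measurable_update'.comp measurable_swap
  have hdensity := (measurable_localDensity ψ hz.ne' N n).ennreal_ofReal
  rw [← map_update_prod_infinitePi _ n, lintegral_map hdensity hupdate,
    lintegral_prod_symm (fun p => ENNReal.ofReal (localDensity ψ z N n (Function.update p.2 n p.1)))
      (hdensity.comp hupdate).aemeasurable]
  calc _ ≤ ∫⁻ _ϰ, ENNReal.ofReal κ * c ∂(Measure.infinitePi fun _ : ℤ => P₀) :=
        lintegral_mono fun ϰ => by
          simp only [hψ.localDensity_update hz hn]
          exact lintegral_mul_im_div_one_add_mul_le hP hκ (borelTransform_im_pos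
            (isSelfAdjoint_truncated ψ _ N) hz (hψ.ne_zero n))
    _ = ENNReal.ofReal κ * c := by simp

theorem IsAdmissible.lintegral_average_localDensity_le (hψ : IsAdmissible ψ)
    (hP : P₀ ≤ c • volume) (hκ : ∀ᵐ t ∂P₀, 0 ≤ t ∧ t ≤ κ) {z : ℂ} (hz : 0 < z.im) (N : ℕ) :
    ∫⁻ ϰ, ENNReal.ofReal ((∑ n ∈ Finset.Icc (-(N : ℤ)) N, localDensity ψ z N n ϰ) / (2 * N + 1))
      ∂(Measure.infinitePi fun _ : ℤ => P₀) ≤ ENNReal.ofReal κ * c := by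
  have hsum : ∀ᵐ ϰ ∂(Measure.infinitePi fun _ : ℤ => P₀),
      ENNReal.ofReal ((∑ n ∈ Finset.Icc (-(N : ℤ)) N, localDensity ψ z N n ϰ) / (2 * N + 1)) =
      (2 * N + 1 : ℝ≥0∞)⁻¹ *
        ∑ n ∈ Finset.Icc (-(N : ℤ)) N, ENNReal.ofReal (localDensity ψ z N n ϰ) := by
    filter_upwards [ae_infinitePi_forall P₀ hκ] with ϰ hϰ
    rw [ENNReal.ofReal_div_of_pos (by positivity), ENNReal.ofReal_sum_of_nonneg fun n _ =>
      hψ.localDensity_nonneg hz N (hϰ n).1, div_eq_mul_inv, mul_comm]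
    norm_cast
  have hmeas := fun n => (measurable_localDensity ψ hz.ne' N n).ennreal_ofReal
  rw [lintegral_congr_ae hsum,
    lintegral_const_mul _ (Finset.measurable_fun_sum _ fun n _ => hmeas n),
    lintegral_finsetSum _ fun n _ => hmeas n]
  calc _ ≤ (2 * N + 1 : ℝ≥0∞)⁻¹ * ∑ _n ∈ Finset.Icc (-(N : ℤ)) N, ENNReal.ofReal κ * c := by
        exact mul_le_mul_right (Finset.sum_le_sum fun _ hn =>
          hψ.lintegral_localDensity_le hP hκ hz hn) _
    _ = ENNReal.ofReal κ * c := by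
        rw [Finset.sum_const, card_Icc_neg_self, nsmul_eq_mul, ← mul_assoc]
        push_cast
        rw [ENNReal.inv_mul_cancel (by positivity) (by finiteness), one_mul]

theorem IsAdmissible.ofReal_integral_mul_cauchyPDFReal_le (hψ : IsAdmissible ψ)
    (hP : P₀ ≤ c • volume) (hκ : ∀ᵐ t ∂P₀, 0 < t ∧ t ≤ κ) {ν : Measure ℝ}
    (hν : IsIDSMeasure ψ P₀ ν) (x : ℝ) {γ : ℝ≥0} (hγ : γ ≠ 0) :
    ENNReal.ofReal (∫ t, t * cauchyPDFReal x γ t ∂ν) ≤ ENNReal.ofReal κ * c := by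
  obtain ⟨C, hC⟩ := exists_abs_mul_cauchyPDFReal_le x hγ
  let f : ℝ →ᵇ ℝ := .ofNormedAddCommGroup (fun t => t * cauchyPDFReal x γ t)
    (continuous_id.mul (continuous_cauchyPDFReal x hγ)) C hC
  have hz : 0 < (⟨x, γ⟩ : ℂ).im := NNReal.coe_pos.2 (pos_iff_ne_zero.2 hγ)
  have hmeas := fun N : ℕ => Finset.measurable_fun_sum (Finset.Icc (-(N : ℤ)) N) fun n _ =>
    measurable_localDensity ψ hz.ne' N n
  refine ofReal_le_of_ae_tendsto_of_lintegral_le (fun N => ((hmeas N).div_const _).aemeasurable) ?_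
    fun N => hψ.lintegral_average_localDensity_le hP (hκ.mono fun t ht => ⟨ht.1.le, ht.2⟩) hz N
  filter_upwards [hν.tendsto, ae_infinitePi_forall P₀ hκ] with ϰ hconv hϰ
  refine (hconv f).congr fun N => ?_
  rw [hψ.integral_countingMeasure (fun n => (hϰ n).1) N f,
    ← sum_truncatedEig_mul_cauchyPDFReal ψ (fun n => (hϰ n).1.le) N x hγ]
  rfl

theorem IsAdmissible.lintegral_mul_cauchyPDF_le (hψ : IsAdmissible ψ)
    (hP : P₀ ≤ c • volume) (hκ : ∀ᵐ t ∂P₀, 0 < t ∧ t ≤ κ) {ν : Measure ℝ}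
    (hν : IsIDSMeasure ψ P₀ ν) (x : ℝ) {γ : ℝ≥0} (hγ : γ ≠ 0) :
    ∫⁻ t, ENNReal.ofReal t * cauchyPDF x γ t ∂ν ≤ ENNReal.ofReal κ * c := by
  have := hν.isProbabilityMeasure
  obtain ⟨C, hC⟩ := exists_abs_mul_cauchyPDFReal_le x hγ
  have hint : Integrable (fun t => t * cauchyPDFReal x γ t) ν := .of_bound
    (continuous_id.mul (continuous_cauchyPDFReal x hγ)).aestronglyMeasurable C (.of_forall hC)
  have hnonneg := hψ.ae_nonneg_of_isIDSMeasure (hκ.mono fun t ht => ht.1) hν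
  calc ∫⁻ t, ENNReal.ofReal t * cauchyPDF x γ t ∂ν
      = ∫⁻ t, ENNReal.ofReal (t * cauchyPDFReal x γ t) ∂ν := lintegral_congr fun t =>
        (ENNReal.ofReal_mul' (cauchyPDF_pos x hγ t).le).symm
    _ = ENNReal.ofReal (∫ t, t * cauchyPDFReal x γ t ∂ν) :=
        (ofReal_integral_eq_lintegral_ofReal hint <| hnonneg.mono fun t ht =>
          mul_nonneg ht (cauchyPDF_pos x hγ t).le).symm
    _ ≤ ENNReal.ofReal κ * c := hψ.ofReal_integral_mul_cauchyPDFReal_le hP hκ hν x hγ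

end Wegner

section CauchyBound

open ProbabilityTheory
open scoped NNReal

theorem cauchyPDF_comm (x : ℝ) (γ : ℝ≥0) (t : ℝ) : cauchyPDF x γ t = cauchyPDF t γ x := by
  rw [cauchyPDF, cauchyPDF, cauchyPDFReal_def, cauchyPDFReal_def, sub_sq_comm]

theorem lintegral_mul_cauchyPDF (x : ℝ) {γ : ℝ≥0} (hγ : γ ≠ 0) {g : ℝ → ℝ≥0∞}
    (hg : Measurable g) :
    ∫⁻ t, g t * cauchyPDF x γ t = ∫⁻ s, g (γ * s + x) * cauchyPDF 0 1 s := by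
  have hγ0 : (γ : ℝ) ≠ 0 := NNReal.coe_ne_zero.2 hγ
  rw [← lintegral_add_right_eq_self _ x]
  nth_rw 1 [← Real.smul_map_volume_mul_left hγ0]
  rw [lintegral_smul_measure, lintegral_map (by fun_prop) (by fun_prop), smul_eq_mul,
    ← lintegral_const_mul _ (by fun_prop)]
  refine lintegral_congr fun s => ?_
  rw [cauchyPDF, cauchyPDF, mul_left_comm, ← ENNReal.ofReal_mul (abs_nonneg _), NNReal.abs_eq,
    cauchyPDFReal_def', cauchyPDFReal_def', add_sub_cancel_right, mul_div_cancel_left₀ s hγ0]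
  congr 2
  simp only [NNReal.coe_inv, NNReal.coe_one, inv_one, mul_one, sub_zero, div_one]
  field_simp

theorem one_le_liminf_setLIntegral_cauchyPDF {U : Set ℝ} (hU : IsOpen U) {x : ℝ} (hx : x ∈ U)
    {γ : ℕ → ℝ≥0} (hγ0 : ∀ n, γ n ≠ 0) (hγ : Tendsto γ atTop (𝓝 0)) :
    1 ≤ liminf (fun n => ∫⁻ t in U, cauchyPDF x (γ n) t) atTop := by
  set g : ℝ → ℝ≥0∞ := U.indicator 1 with hg
  have hgm : Measurable g := measurable_one.indicator hU.measurableSet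
  have hscale : ∀ n, ∫⁻ t in U, cauchyPDF x (γ n) t =
      ∫⁻ s, g (γ n * s + x) * cauchyPDF 0 1 s := fun n => by
    rw [← lintegral_mul_cauchyPDF x (hγ0 n) hgm, ← lintegral_indicator hU.measurableSet]
    refine lintegral_congr fun t => ?_
    by_cases ht : t ∈ U <;> simp [hg, ht]
  have hlim : ∀ s : ℝ, Tendsto (fun n => g (γ n * s + x) * cauchyPDF 0 1 s) atTop
      (𝓝 (cauchyPDF 0 1 s)) := fun s => by
    have hconv : Tendsto (fun n => γ n * s + x) atTop (𝓝 x) := by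
      simpa using ((NNReal.tendsto_coe.2 hγ).mul_const s).add_const x
    refine tendsto_const_nhds.congr' ?_
    filter_upwards [hconv.eventually (hU.mem_nhds hx)] with n hn
    rw [hg, Set.indicator_of_mem hn, Pi.one_apply, one_mul]
  calc 1 = ∫⁻ s, liminf (fun n => g (γ n * s + x) * cauchyPDF 0 1 s) atTop := by
        rw [← lintegral_cauchyPDF_eq_one 0 one_ne_zero]
        exact lintegral_congr fun s => (hlim s).liminf_eq.symm
    _ ≤ liminf (fun n => ∫⁻ s, g (γ n * s + x) * cauchyPDF 0 1 s) atTop :=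
        lintegral_liminf_le fun n => by fun_prop
    _ = liminf (fun n => ∫⁻ t in U, cauchyPDF x (γ n) t) atTop := by simp_rw [hscale]

variable {μ : Measure ℝ} [SFinite μ] {c : ℝ≥0∞}

theorem measure_le_of_isOpen_of_lintegral_cauchyPDF_le
    (h : ∀ (x : ℝ) (γ : ℝ≥0), γ ≠ 0 → ∫⁻ t, cauchyPDF x γ t ∂μ ≤ c)
    {U : Set ℝ} (hU : IsOpen U) : μ U ≤ c * volume U := by
  set γ : ℕ → ℝ≥0 := fun n => 1 / ((n : ℝ≥0) + 1)
  have hγ0 : ∀ n, γ n ≠ 0 := fun n => by positivity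
  have hγ : Tendsto γ atTop (𝓝 0) := tendsto_one_div_add_atTop_nhds_zero_nat
  have hjoint : ∀ n, Measurable fun p : ℝ × ℝ => cauchyPDF p.1 (γ n) p.2 := fun n => by
    unfold cauchyPDF cauchyPDFReal
    fun_prop
  calc μ U = ∫⁻ _ in U, 1 ∂μ := (setLIntegral_one U).symm
    _ ≤ ∫⁻ x in U, liminf (fun n => ∫⁻ t in U, cauchyPDF x (γ n) t) atTop ∂μ :=
        setLIntegral_mono' hU.measurableSet fun x hx =>
          one_le_liminf_setLIntegral_cauchyPDF hU hx hγ0 hγ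
    _ ≤ ∫⁻ x, liminf (fun n => ∫⁻ t in U, cauchyPDF x (γ n) t) atTop ∂μ :=
        setLIntegral_le_lintegral U _
    _ ≤ liminf (fun n => ∫⁻ x, (∫⁻ t in U, cauchyPDF x (γ n) t) ∂μ) atTop :=
        lintegral_liminf_le fun n => (hjoint n).lintegral_prod_right'
    _ = liminf (fun n => ∫⁻ t in U, ∫⁻ x, cauchyPDF t (γ n) x ∂μ) atTop := by
        congr 1 with n
        rw [lintegral_lintegral_swap (hjoint n).aemeasurable]
        simp only [cauchyPDF_comm _ (γ n)]
    _ ≤ liminf (fun _ : ℕ => c * volume U) atTop :=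
        liminf_le_liminf <| .of_forall fun n =>
          (lintegral_mono fun t => h t (γ n) (hγ0 n)).trans_eq (setLIntegral_const U c)
    _ = c * volume U := liminf_const _

theorem le_smul_volume_of_lintegral_cauchyPDF_le (hc : c ≠ ∞)
    (h : ∀ (x : ℝ) (γ : ℝ≥0), γ ≠ 0 → ∫⁻ t, cauchyPDF x γ t ∂μ ≤ c) : μ ≤ c • volume := by
  have : (c • (volume : Measure ℝ)).OuterRegular := Measure.OuterRegular.smul _ hc
  refine Measure.le_iff'.2 fun A => ?_
  rw [A.measure_eq_iInf_isOpen (c • volume)]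
  exact le_iInf₂ fun U hAU => le_iInf fun hU =>
    (measure_mono hAU).trans (measure_le_of_isOpen_of_lintegral_cauchyPDF_le h hU)

end CauchyBound

section Density

variable {ν : Measure ℝ}

theorem restrict_compl_zero_absolutelyContinuous (hν : ∀ᵐ t ∂ν, 0 ≤ t)
    (h : ν.withDensity ENNReal.ofReal ≪ volume) : ν.restrict {0}ᶜ ≪ volume := by
  have hne : ∀ᵐ t ∂ν.restrict {0}ᶜ, ENNReal.ofReal t ≠ 0 := by
    filter_upwards [ae_restrict_of_ae hν, ae_restrict_mem (measurableSet_singleton 0).compl]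
      with t ht ht0
    simpa using lt_of_le_of_ne ht (Ne.symm ht0)
  refine (withDensity_absolutelyContinuous' ENNReal.measurable_ofReal.aemeasurable hne).trans ?_
  rw [← restrict_withDensity (measurableSet_singleton 0).compl]
  exact Measure.restrict_le_self.absolutelyContinuous.trans h

theorem rnDeriv_le_ofReal_div {C : ℝ}
    (h : ν.withDensity ENNReal.ofReal ≤ ENNReal.ofReal C • volume) :
    ∀ᵐ t ∂(volume : Measure ℝ), 0 < t → ν.rnDeriv volume t ≤ ENNReal.ofReal (C / t) := by
  have hr := Measure.measurable_rnDeriv ν volume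
  have hmul : (fun t => ν.rnDeriv volume t * ENNReal.ofReal t) ≤ᵐ[volume]
      fun _ => ENNReal.ofReal C := by
    refine ae_le_of_forall_setLIntegral_le_of_sigmaFinite (by fun_prop) fun s hs _ => ?_
    calc ∫⁻ t in s, ν.rnDeriv volume t * ENNReal.ofReal t
        = ∫⁻ t in s, ENNReal.ofReal t ∂(volume.withDensity (ν.rnDeriv volume)) :=
          (setLIntegral_withDensity_eq_setLIntegral_mul _ hr ENNReal.measurable_ofReal hs).symm
      _ ≤ ∫⁻ t in s, ENNReal.ofReal t ∂ν :=
          lintegral_mono' (Measure.restrict_mono le_rfl (Measure.withDensity_rnDeriv_le ν volume))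
            le_rfl
      _ = ν.withDensity ENNReal.ofReal s := (withDensity_apply _ hs).symm
      _ ≤ ENNReal.ofReal C * volume s := h s
      _ = ∫⁻ _ in s, ENNReal.ofReal C := (setLIntegral_const s _).symm
  filter_upwards [hmul] with t ht ht0
  rw [ENNReal.ofReal_div_of_pos ht0]
  exact ENNReal.le_div_iff_mul_le (.inl (by simpa using ht0)) (.inl ENNReal.ofReal_ne_top) |>.2 ht

end Density

section DensityOfStates

variable {H : Type*} [NormedAddCommGroup H] [InnerProductSpace ℂ H] [CompleteSpace H] {ψ : ℤ → H}

theorem IsAdmissible.withDensity_ofReal_le_smul_volume (hψ : IsAdmissible ψ) {P₀ : Measure ℝ}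
    [IsProbabilityMeasure P₀] {C κ : ℝ} (hP : P₀ ≤ ENNReal.ofReal C • volume)
    (hκ : ∀ᵐ t ∂P₀, 0 < t ∧ t ≤ κ) {ν : Measure ℝ} (hν : IsIDSMeasure ψ P₀ ν) :
    ν.withDensity ENNReal.ofReal ≤ ENNReal.ofReal (C * κ) • volume := by
  have := hν.isProbabilityMeasure
  obtain ⟨t, ht⟩ := hκ.exists
  rw [mul_comm, ENNReal.ofReal_mul (ht.1.le.trans ht.2)]
  refine le_smul_volume_of_lintegral_cauchyPDF_le (by finiteness) fun x γ hγ => ?_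
  rw [lintegral_withDensity_eq_lintegral_mul ν ENNReal.measurable_ofReal (by fun_prop)]
  exact hψ.lintegral_mul_cauchyPDF_le hP hκ hν x hγ

end DensityOfStates

section FourierUniqueness

section

variable {X E : Type*} [TopologicalSpace X] [MeasurableSpace X] [BorelSpace X]
  [HasOuterApproxClosed X] [NormedAddCommGroup E] [NormedSpace ℝ E] [CompleteSpace E]
  {μ : Measure X} {F : X → E}

theorem ae_eq_zero_of_forall_integral_nnreal_smul_eq_zero (hF : Integrable F μ)
    (h : ∀ q : X →ᵇ NNReal, ∫ x, (q x : ℝ) • F x ∂μ = 0) : F =ᵐ[μ] 0 := by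
  refine ae_eq_zero_of_forall_setIntegral_isClosed_eq_zero hF fun s hs => ?_
  have hlim : Tendsto (fun n => ∫ x, (hs.apprSeq n x : ℝ) • F x ∂μ) atTop
      (𝓝 (∫ x, s.indicator F x ∂μ)) := by
    refine tendsto_integral_of_dominated_convergence (fun x => ‖F x‖) (fun n => ?_) hF.norm
      (fun n => .of_forall fun x => ?_) (.of_forall fun x => ?_)
    · have hq := NNReal.continuous_coe.comp (hs.apprSeq n).continuous
      exact hq.measurable.aestronglyMeasurable.smul hF.aestronglyMeasurable
    · rw [norm_smul, NNReal.norm_eq]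
      exact mul_le_of_le_one_left (norm_nonneg _)
        (HasOuterApproxClosed.apprSeq_apply_le_one hs n x)
    · have hx := tendsto_pi_nhds.1 (HasOuterApproxClosed.tendsto_apprSeq hs) x
      have hind : s.indicator F x = ((s.indicator (fun _ => 1) x : NNReal) : ℝ) • F x := by
        by_cases hxs : x ∈ s <;> simp [hxs]
      exact hind ▸ (NNReal.tendsto_coe.2 hx).smul_const (F x)
  rw [← integral_indicator hs.measurableSet]
  exact tendsto_nhds_unique hlim (by simp only [h, tendsto_const_nhds_iff])

end

section

variable {X : Type*} [TopologicalSpace X] [CompactSpace X] [MeasurableSpace X]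
  [OpensMeasurableSpace X] {μ : Measure X} {F : X → ℂ}

theorem integrable_continuousMap_mul (hF : Integrable F μ) (q : C(X, ℂ)) :
    Integrable (fun x => q x * F x) μ :=
  hF.bdd_mul q.continuous.measurable.aestronglyMeasurable (.of_forall q.norm_coe_le_norm)

/-- The continuous functional `q ↦ ∫ q F dμ` on continuous functions, for integrable `F`. -/
noncomputable def integralMulCLM (hF : Integrable F μ) : C(X, ℂ) →L[ℂ] ℂ :=
  LinearMap.mkContinuous
    { toFun := fun q => ∫ x, q x * F x ∂μ
      map_add' := fun p q => by
        simp only [ContinuousMap.add_apply, add_mul]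
        exact integral_add (integrable_continuousMap_mul hF p) (integrable_continuousMap_mul hF q)
      map_smul' := fun c q => by
        simp only [ContinuousMap.smul_apply, smul_eq_mul, mul_assoc, integral_const_mul,
          RingHom.id_apply] }
    (∫ x, ‖F x‖ ∂μ) fun q => by
      rw [mul_comm, ← integral_const_mul]
      refine norm_integral_le_of_norm_le (hF.norm.const_mul _) (.of_forall fun x => ?_)
      rw [norm_mul]
      gcongr
      exact q.norm_coe_le_norm x

end

variable {T : ℝ} [hT : Fact (0 < T)]

theorem ae_eq_zero_of_forall_integral_fourier_mul_eq_zero {μ : Measure (AddCircle T)}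
    {F : AddCircle T → ℂ} (hF : Integrable F μ) (h : ∀ n : ℤ, ∫ x, fourier n x * F x ∂μ = 0) :
    F =ᵐ[μ] 0 := by
  have hker : (Submodule.span ℂ (Set.range (fourier (T := T)))).topologicalClosure ≤
      (integralMulCLM hF).toLinearMap.ker :=
    Submodule.topologicalClosure_minimal _
      (Submodule.span_le.2 <| Set.range_subset_iff.2 h) (integralMulCLM hF).isClosed_ker
  rw [span_fourier_closure_eq_top] at hker
  refine ae_eq_zero_of_forall_integral_nnreal_smul_eq_zero hF fun q => ?_
  simp_rw [Complex.real_smul]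
  exact hker (Submodule.mem_top (x := ⟨fun x => ((q x : ℝ) : ℂ), by fun_prop⟩))

end FourierUniqueness

section Modulation

variable {T : ℝ} [hT : Fact (0 < T)]

theorem memLp_fourier_mul (φ : Lp ℂ 2 (AddCircle.haarAddCircle (T := T))) (m : ℤ) :
    MemLp (fun x => fourier m x * φ x) 2 (AddCircle.haarAddCircle (T := T)) := by
  refine (Lp.memLp φ).of_le ((fourier m).continuous.aestronglyMeasurable.mul
    (Lp.aestronglyMeasurable φ)) (.of_forall fun x => ?_)
  rw [norm_mul, fourier_apply, Circle.norm_coe, one_mul]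

/-- The product `e_m φ` of a square integrable function with a trigonometric monomial. -/
noncomputable def modulation (φ : Lp ℂ 2 (AddCircle.haarAddCircle (T := T))) (m : ℤ) :
    Lp ℂ 2 (AddCircle.haarAddCircle (T := T)) :=
  (memLp_fourier_mul φ m).toLp _

theorem coeFn_modulation (φ : Lp ℂ 2 (AddCircle.haarAddCircle (T := T))) (m : ℤ) :
    modulation φ m =ᵐ[AddCircle.haarAddCircle] fun x => fourier m x * φ x :=
  MemLp.coeFn_toLp _

theorem inner_fourierLp_modulation (φ : Lp ℂ 2 (AddCircle.haarAddCircle (T := T))) (n m : ℤ) :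
    inner ℂ (fourierLp 2 n) (modulation φ m) = fourierCoeff φ (n - m) := by
  rw [← coe_fourierBasis, ← fourierBasis.repr_apply_apply, fourierBasis_repr,
    fourierCoeff_congr_ae (coeFn_modulation φ m)]
  refine integral_congr_ae (.of_forall fun x => ?_)
  simp only [smul_eq_mul]
  rw [← mul_assoc, ← fourier_add, neg_sub, neg_add_eq_sub]

/-- Wiener's theorem on cyclic vectors of the bilateral shift. -/
theorem topologicalClosure_span_modulation {φ : Lp ℂ 2 (AddCircle.haarAddCircle (T := T))}
    (hφ : ∀ᵐ x ∂(AddCircle.haarAddCircle (T := T)), φ x ≠ 0) :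
    (Submodule.span ℂ (Set.range (modulation φ))).topologicalClosure = ⊤ := by
  rw [Submodule.topologicalClosure_eq_top_iff, Submodule.eq_bot_iff]
  intro f hf
  have horth : ∀ n : ℤ,
      ∫ x, fourier n x * inner ℂ (φ x) (f x) ∂AddCircle.haarAddCircle = 0 := fun n => by
    rw [← (Submodule.mem_orthogonal _ _).1 hf (modulation φ (-n))
      (Submodule.subset_span ⟨-n, rfl⟩), L2.inner_def]
    refine integral_congr_ae ?_
    filter_upwards [coeFn_modulation φ (-n)] with x hx
    rw [hx, RCLike.inner_apply', RCLike.inner_apply', map_mul, ← fourier_neg, neg_neg, mul_assoc]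
  rw [Lp.eq_zero_iff_ae_eq_zero]
  filter_upwards [ae_eq_zero_of_forall_integral_fourier_mul_eq_zero (L2.integrable_inner φ f) horth,
    hφ] with x hx hφx
  simpa [RCLike.inner_apply', hφx] using hx

theorem exists_norm_sub_sum_modulation_lt {φ : Lp ℂ 2 (AddCircle.haarAddCircle (T := T))}
    (hφ : ∀ᵐ x ∂(AddCircle.haarAddCircle (T := T)), φ x ≠ 0)
    (f : Lp ℂ 2 (AddCircle.haarAddCircle (T := T))) {η : ℝ} (hη : 0 < η) :
    ∃ c : ℤ →₀ ℂ, ‖f - c.sum fun m a => a • modulation φ m‖ < η := by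
  have hf : f ∈ (Submodule.span ℂ (Set.range (modulation φ))).topologicalClosure := by
    rw [topologicalClosure_span_modulation hφ]
    exact Submodule.mem_top
  obtain ⟨u, hu, hlt⟩ := Metric.mem_closure_iff.1 hf η hη
  obtain ⟨c, rfl⟩ := Finsupp.mem_span_range_iff_exists_finsupp.1 hu
  exact ⟨c, dist_eq_norm f _ ▸ hlt⟩

end Modulation

section Symbol

variable {H : Type*} [NormedAddCommGroup H] [InnerProductSpace ℂ H] {ψ : ℤ → H}

theorem IsAdmissible.fourierCoeff_symbol (hψ : IsAdmissible ψ) (n : ℤ) :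
    fourierCoeff (symbol ψ) n = gramEntry ψ n 0 := by
  have hmem : Memℓp (fun n => gramEntry ψ n 0) 2 :=
    memℓp_gen (hψ.summable_norm_gramEntry_sq.congr fun n => by norm_num)
  have hsum := HilbertBasis.hasSum_repr_symm (fourierBasis (T := (1 : ℝ))) ⟨_, hmem⟩
  rw [coe_fourierBasis] at hsum
  rw [← fourierBasis_repr, symbol, hsum.tsum_eq, LinearIsometryEquiv.apply_symm_apply]

theorem IsAdmissible.inner_fourierLp_modulation_symbol (hψ : IsAdmissible ψ) (n m : ℤ) :
    inner ℂ (fourierLp 2 n) (modulation (symbol ψ) m) = inner ℂ (ψ m) (ψ n) := by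
  rw [inner_fourierLp_modulation, hψ.fourierCoeff_symbol, hψ.inner_eq_gramEntry_sub]

/-- An approximate version of a vector `Y` biorthogonal to `ψ_0`, with `⟨Y, ψ_n⟩ = δ_{n0}`: an exact
one need not exist, but the defect is controlled through the orthonormal family `e_n`. -/
theorem IsAdmissible.exists_inner_add_inner_fourierLp_eq (hψ : IsAdmissible ψ)
    (hφ : ∀ᵐ k ∂(AddCircle.haarAddCircle (T := (1 : ℝ))), symbol ψ k ≠ 0) {η : ℝ} (hη : 0 < η) :
    ∃ (Y : H) (W : Lp ℂ 2 (AddCircle.haarAddCircle (T := (1 : ℝ)))), ‖W‖ < η ∧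
      ∀ n, inner ℂ Y (ψ n) + inner ℂ (fourierLp 2 n) W = if n = 0 then 1 else 0 := by
  obtain ⟨c, hc⟩ := exists_norm_sub_sum_modulation_lt hφ (fourierLp 2 0) hη
  refine ⟨c.sum fun m a => starRingEnd ℂ a • ψ m, _, hc, fun n => ?_⟩
  have hmod : inner ℂ (fourierLp 2 n) (c.sum fun m a => a • modulation (symbol ψ) m) =
      inner ℂ (c.sum fun m a => starRingEnd ℂ a • ψ m) (ψ n) := by
    simp only [Finsupp.sum, inner_sum, sum_inner, inner_smul_left, inner_smul_right,
      hψ.inner_fourierLp_modulation_symbol, Complex.conj_conj]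
  rw [inner_sub_right, hmod, add_sub_cancel, orthonormal_iff_ite.1 orthonormal_fourier]

theorem IsAdmissible.norm_synthesis_sub (hψ : IsAdmissible ψ) {S : Finset ℤ}
    (x : EuclideanSpace ℂ S) (j : ℤ) :
    ‖synthesis (fun i : S => ψ (i - j)) x‖ = ‖synthesis (fun i : S => ψ i) x‖ := by
  simpa only [synthesis_apply, sub_eq_add_neg] using
    hψ.norm_sum_smul_add Finset.univ x (fun i : S => (i : ℤ)) (-j)

theorem norm_sum_smul_sq_of_orthonormal {𝕜 E ι : Type*} [RCLike 𝕜] [NormedAddCommGroup E]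
    [InnerProductSpace 𝕜 E] [Fintype ι] {v : ι → E} (hv : Orthonormal 𝕜 v) (a : ι → 𝕜) :
    ‖∑ i, a i • v i‖ ^ 2 = ∑ i, ‖a i‖ ^ 2 := by
  rw [InnerProductSpace.norm_sq_eq_re_inner (𝕜 := 𝕜), hv.inner_sum]
  simp only [RCLike.conj_mul, map_sum, ← RCLike.ofReal_pow, RCLike.ofReal_re]

theorem sq_add_le_add_div_mul_add {p q r s δ : ℝ} (hδ : 0 < δ) :
    (p * q + r * s) ^ 2 ≤ (p ^ 2 + s ^ 2 / δ) * (q ^ 2 + δ * r ^ 2) := by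
  have hdiff : (p ^ 2 + s ^ 2 / δ) * (q ^ 2 + δ * r ^ 2) - (p * q + r * s) ^ 2 =
      (δ * p * r - q * s) ^ 2 / δ := by
    field_simp
    ring
  have : 0 ≤ (δ * p * r - q * s) ^ 2 / δ := by positivity
  linarith

theorem IsAdmissible.exists_norm_apply_sq_le (hψ : IsAdmissible ψ)
    (hφ : ∀ᵐ k ∂(AddCircle.haarAddCircle (T := (1 : ℝ))), symbol ψ k ≠ 0) {η : ℝ} (hη : 0 < η) :
    ∃ K : ℝ, 0 ≤ K ∧ ∀ (δ : ℝ), 0 < δ → ∀ (S : Finset ℤ) (j : S) (x : EuclideanSpace ℂ S),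
      ‖x j‖ ^ 2 ≤ (K + η ^ 2 / δ) * (‖synthesis (fun i : S => ψ i) x‖ ^ 2 + δ * ‖x‖ ^ 2) := by
  obtain ⟨Y, W, hW, hYW⟩ := hψ.exists_inner_add_inner_fourierLp_eq hφ hη
  refine ⟨‖Y‖ ^ 2, by positivity, fun δ hδ S j x => ?_⟩
  set Z : H := synthesis (fun i : S => ψ (i - j)) x with hZ
  have hon : Orthonormal ℂ fun i : S => fourierLp (T := (1 : ℝ)) 2 (i - j : ℤ) :=
    orthonormal_fourier.comp _ ((sub_left_injective (b := (j : ℤ))).comp Subtype.val_injective)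
  set X := ∑ i : S, starRingEnd ℂ (x i) • fourierLp (T := (1 : ℝ)) 2 (i - j : ℤ) with hX
  have hXnorm : ‖X‖ ^ 2 = ‖x‖ ^ 2 := by
    simp only [hX, norm_sum_smul_sq_of_orthonormal hon, Complex.norm_conj,
      EuclideanSpace.norm_sq_eq]
  have hxj : x j = inner ℂ Y Z + inner ℂ X W := by
    simp only [hZ, hX, synthesis_apply, inner_sum, sum_inner, inner_smul_right, inner_smul_left,
      Complex.conj_conj, ← Finset.sum_add_distrib, ← mul_add, hYW, sub_eq_zero, Subtype.coe_inj,
      mul_ite, mul_one, mul_zero, Finset.sum_ite_eq', Finset.mem_univ, if_true]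
  have hnorm : ‖x j‖ ≤ ‖Y‖ * ‖Z‖ + ‖X‖ * η := by
    rw [hxj]
    exact (norm_add_le _ _).trans (add_le_add (norm_inner_le_norm _ _)
      ((norm_inner_le_norm _ _).trans (by gcongr)))
  calc ‖x j‖ ^ 2 ≤ (‖Y‖ * ‖Z‖ + ‖X‖ * η) ^ 2 := by gcongr
    _ ≤ (‖Y‖ ^ 2 + η ^ 2 / δ) * (‖Z‖ ^ 2 + δ * ‖X‖ ^ 2) := sq_add_le_add_div_mul_add hδ
    _ = _ := by rw [hZ, hψ.norm_synthesis_sub, hXnorm]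

end Symbol

section Atom

variable {H : Type*} [NormedAddCommGroup H] [InnerProductSpace ℂ H]

section

variable {ι : Type*} [Fintype ι]

theorem synthesis_weighted (v : ι → H) (c : ι → ℝ) (x : EuclideanSpace ℂ ι) :
    synthesis (weighted v c) x = synthesis v (WithLp.toLp 2 fun i => (√(c i) : ℂ) * x i) := by
  simp only [synthesis_apply, weighted, smul_smul, mul_comm]

theorem norm_apply_sq_le_weighted {v : ι → H} {c : ι → ℝ} {a κ ε M : ℝ} (ha : 0 < a) (hε : 0 ≤ ε)
    (hM : 0 ≤ M) (hc : ∀ i, a ≤ c i ∧ c i ≤ κ) {j : ι}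
    (h : ∀ x : EuclideanSpace ℂ ι, ‖x j‖ ^ 2 ≤ M * (‖synthesis v x‖ ^ 2 + ε * ‖x‖ ^ 2))
    (x : EuclideanSpace ℂ ι) :
    ‖x j‖ ^ 2 ≤ M / a * (‖synthesis (weighted v c) x‖ ^ 2 + ε * κ * ‖x‖ ^ 2) := by
  set y : EuclideanSpace ℂ ι := WithLp.toLp 2 fun i => (√(c i) : ℂ) * x i with hy
  have hyi : ∀ i, ‖y i‖ ^ 2 = c i * ‖x i‖ ^ 2 := fun i => by
    rw [hy, norm_mul, mul_pow, Complex.norm_real, Real.norm_eq_abs, sq_abs,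
      Real.sq_sqrt (ha.le.trans (hc i).1)]
  have hynorm : ‖y‖ ^ 2 ≤ κ * ‖x‖ ^ 2 := by
    simp only [EuclideanSpace.norm_sq_eq, hyi, Finset.mul_sum]
    gcongr with i
    exact (hc i).2
  rw [div_mul_eq_mul_div, le_div_iff₀' ha]
  calc a * ‖x j‖ ^ 2 ≤ ‖y j‖ ^ 2 := by rw [hyi]; gcongr; exact (hc j).1
    _ ≤ M * (‖synthesis v y‖ ^ 2 + ε * ‖y‖ ^ 2) := h y
    _ ≤ M * (‖synthesis (weighted v c) x‖ ^ 2 + ε * κ * ‖x‖ ^ 2) := by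
        rw [synthesis_weighted, mul_assoc]
        gcongr

end

theorem sum_inv_truncatedEig_add_le {ψ : ℤ → H} {ϰ : ℤ → ℝ} {a κ ε M : ℝ} (ha : 0 < a)
    (hε : 0 < ε) (hM : 0 ≤ M) (hϰ : ∀ n, a ≤ ϰ n ∧ ϰ n ≤ κ) {N : ℕ}
    (h : ∀ (j : Finset.Icc (-(N : ℤ)) N) (x : EuclideanSpace ℂ (Finset.Icc (-(N : ℤ)) N)),
      ‖x j‖ ^ 2 ≤
        M * (‖synthesis (fun i : Finset.Icc (-(N : ℤ)) N => ψ i) x‖ ^ 2 + ε * ‖x‖ ^ 2)) :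
    ∑ k, (truncatedEig ψ ϰ N k + ε * κ)⁻¹ ≤ (2 * N + 1) * (M / a) := by
  have hκ : 0 < κ := ha.trans_le ((hϰ 0).1.trans (hϰ 0).2)
  refine (sum_inv_gramEig_add_le (fun n : Finset.Icc (-(N : ℤ)) N => weighted ψ ϰ n)
    (mul_pos hε hκ) (C := fun _ => M / a) (fun _ => by positivity) fun j =>
      norm_apply_sq_le_weighted (v := fun n : Finset.Icc (-(N : ℤ)) N => ψ n)
        (c := fun n : Finset.Icc (-(N : ℤ)) N => ϰ n) ha hε.le hM (fun n => hϰ n)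
        (h j)).trans_eq ?_
  rw [Finset.sum_const, Finset.card_univ, Fintype.card_coe, card_Icc_neg_self, nsmul_eq_mul]
  push_cast
  rfl

/-- The function `t ↦ δ / (|t| + δ)`, which decreases to the indicator function of the origin as
`δ` decreases to zero. -/
noncomputable def originBump {δ : ℝ} (hδ : 0 < δ) : ℝ →ᵇ ℝ :=
  .ofNormedAddCommGroup (fun t => δ / (|t| + δ))
    (continuous_const.div (by fun_prop) fun t => by positivity) 1 fun t => by
      rw [Real.norm_of_nonneg (by positivity)]
      exact div_le_one_of_le₀ (by linarith [abs_nonneg t]) (by positivity)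

theorem measureReal_singleton_zero_le_integral_originBump (ν : Measure ℝ) [IsFiniteMeasure ν]
    {δ : ℝ} (hδ : 0 < δ) : ν.real {0} ≤ ∫ t, originBump hδ t ∂ν := by
  rw [← integral_indicator_one (measurableSet_singleton 0)]
  refine integral_mono ((integrable_const 1).indicator (measurableSet_singleton 0))
    ((originBump hδ).integrable ν) fun t => ?_
  change _ ≤ δ / (|t| + δ)
  by_cases ht : t = 0
  · simp [ht, hδ.ne']
  · rw [Set.indicator_of_notMem (s := {0}) ht]
    positivity

variable {ψ : ℤ → H}

theorem IsAdmissible.integral_originBump_countingMeasure_le (hψ : IsAdmissible ψ) {ϰ : ℤ → ℝ}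
    {a κ ε M : ℝ} (ha : 0 < a) (hε : 0 < ε) (hM : 0 ≤ M) (hϰ : ∀ n, a ≤ ϰ n ∧ ϰ n ≤ κ) {N : ℕ}
    (h : ∀ (j : Finset.Icc (-(N : ℤ)) N) (x : EuclideanSpace ℂ (Finset.Icc (-(N : ℤ)) N)),
      ‖x j‖ ^ 2 ≤
        M * (‖synthesis (fun i : Finset.Icc (-(N : ℤ)) N => ψ i) x‖ ^ 2 + ε * ‖x‖ ^ 2))
    (hδ : 0 < ε * κ) :
    ∫ t, originBump hδ t ∂(countingMeasure ψ ϰ N) ≤ ε * κ * (M / a) := by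
  have hpos : ∀ n, 0 < ϰ n := fun n => ha.trans_le (hϰ n).1
  have hbump : ∀ i, originBump hδ (truncatedEig ψ ϰ N i) =
      ε * κ * (truncatedEig ψ ϰ N i + ε * κ)⁻¹ := fun i => by
    change ε * κ / (|truncatedEig ψ ϰ N i| + ε * κ) = _
    rw [abs_of_pos (hψ.truncatedEig_pos hpos N i), div_eq_mul_inv]
  rw [hψ.integral_countingMeasure hpos, div_le_iff₀ (by positivity)]
  calc ∑ i, originBump hδ (truncatedEig ψ ϰ N i)
      = ε * κ * ∑ i, (truncatedEig ψ ϰ N i + ε * κ)⁻¹ := by simp_rw [hbump, Finset.mul_sum]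
    _ ≤ ε * κ * ((2 * N + 1) * (M / a)) := by
        gcongr
        exact sum_inv_truncatedEig_add_le ha hε hM hϰ h
    _ = ε * κ * (M / a) * (2 * N + 1) := by ring

variable {P₀ : Measure ℝ} [IsProbabilityMeasure P₀] {ν : Measure ℝ} {a κ : ℝ}

theorem IsAdmissible.measureReal_singleton_zero_le (hψ : IsAdmissible ψ) (ha : 0 < a)
    (hP : ∀ᵐ t ∂P₀, a ≤ t ∧ t ≤ κ) (hν : IsIDSMeasure ψ P₀ ν) {ε M : ℝ} (hε : 0 < ε) (hM : 0 ≤ M)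
    (h : ∀ (S : Finset ℤ) (j : S) (x : EuclideanSpace ℂ S),
      ‖x j‖ ^ 2 ≤ M * (‖synthesis (fun i : S => ψ i) x‖ ^ 2 + ε * ‖x‖ ^ 2)) :
    ν.real {0} ≤ ε * κ * (M / a) := by
  have := hν.isProbabilityMeasure
  obtain ⟨ϰ, hlim, hϰ⟩ := (hν.tendsto.and (ae_infinitePi_forall P₀ hP)).exists
  have hδ : 0 < ε * κ := mul_pos hε (ha.trans_le ((hϰ 0).1.trans (hϰ 0).2))
  exact (measureReal_singleton_zero_le_integral_originBump ν hδ).trans <|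
    le_of_tendsto' (hlim (originBump hδ)) fun N =>
      hψ.integral_originBump_countingMeasure_le ha hε hM hϰ (h _) hδ

theorem IsAdmissible.measure_singleton_zero_eq_zero (hψ : IsAdmissible ψ) (ha : 0 < a)
    (hP : ∀ᵐ t ∂P₀, a ≤ t ∧ t ≤ κ) (hν : IsIDSMeasure ψ P₀ ν)
    (hφ : ∀ᵐ k ∂(AddCircle.haarAddCircle (T := (1 : ℝ))), symbol ψ k ≠ 0) : ν {0} = 0 := by
  have := hν.isProbabilityMeasure
  have hη : ∀ η : ℝ, 0 < η → ν.real {0} ≤ η ^ 2 * κ / a := by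
    intro η hη
    obtain ⟨K, hK, hbound⟩ := hψ.exists_norm_apply_sq_le hφ hη
    have hε : ∀ ε : ℝ, 0 < ε → ν.real {0} ≤ (ε * K + η ^ 2) * κ / a := fun ε hε => by
      have hle := hψ.measureReal_singleton_zero_le ha hP hν hε (by positivity) (hbound ε hε)
      exact hle.trans_eq (by field_simp)
    have hlim : Tendsto (fun ε : ℝ => (ε * K + η ^ 2) * κ / a) (𝓝[>] 0) (𝓝 (η ^ 2 * κ / a)) :=
      (Continuous.tendsto' (by fun_prop) 0 _ (by simp)).mono_left nhdsWithin_le_nhds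
    exact ge_of_tendsto hlim (eventually_mem_nhdsWithin.mono hε)
  have hlim : Tendsto (fun η : ℝ => η ^ 2 * κ / a) (𝓝[>] 0) (𝓝 0) :=
    (Continuous.tendsto' (by fun_prop) 0 _ (by simp)).mono_left nhdsWithin_le_nhds
  exact (measureReal_eq_zero_iff).1 <|
    (ge_of_tendsto hlim (eventually_mem_nhdsWithin.mono hη)).antisymm measureReal_nonneg

end Atom

theorem exists_pos_ae_le_and_le_sSup_support {P : Measure ℝ} [NeZero P]
    (hcompact : IsCompact P.support) (hpos : P.support ⊆ Set.Ioi 0) :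
    ∃ a, 0 < a ∧ ∀ᵐ x ∂P, a ≤ x ∧ x ≤ sSup P.support := by
  have hmem : ∀ᵐ x ∂P, x ∈ P.support := Measure.support_mem_ae
  obtain ⟨a, ha, hmin⟩ := hcompact.exists_isLeast hmem.exists
  exact ⟨a, hpos ha, hmem.mono fun x hx => ⟨hmin hx, le_csSup hcompact.bddAbove hx⟩⟩

end RankOneSum

theorem mainTheorem6 {H : Type*} [NormedAddCommGroup H] [InnerProductSpace ℂ H] [CompleteSpace H]
    (ψ : ℤ → H) (hψ : RankOneSum.IsAdmissible ψ)
    (P₀ : Measure ℝ) [IsProbabilityMeasure P₀]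
    (hcompact : IsCompact P₀.support) (hpos : P₀.support ⊆ Set.Ioi 0)
    (ρ : ℝ → ℝ) (hρ_meas : Measurable ρ) (hρ_nonneg : ∀ x, 0 ≤ ρ x)
    (hρ : P₀ = volume.withDensity fun x => ENNReal.ofReal (ρ x))
    (ρmax : ℝ) (hρmax : ∀ᵐ x ∂(volume : Measure ℝ), ρ x ≤ ρmax) :
    (∃ ν : Measure ℝ, RankOneSum.IsIDSMeasure ψ P₀ ν) ∧
    ∀ ν : Measure ℝ, RankOneSum.IsIDSMeasure ψ P₀ ν →
      ν.restrict {0}ᶜ ≪ volume ∧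
      (∀ᵐ t ∂(volume : Measure ℝ), 0 < t →
        ν.rnDeriv volume t ≤ ENNReal.ofReal (ρmax * sSup P₀.support / t)) ∧
      ((∀ᵐ k ∂(AddCircle.haarAddCircle (T := (1 : ℝ))), RankOneSum.symbol ψ k ≠ 0) →
        ν ≪ volume) := by
  obtain ⟨a, ha, hP⟩ := RankOneSum.exists_pos_ae_le_and_le_sSup_support hcompact hpos
  have hP' : ∀ᵐ x ∂P₀, 0 < x ∧ x ≤ sSup P₀.support := hP.mono fun x hx => ⟨ha.trans_le hx.1, hx.2⟩
  refine ⟨hψ.exists_isIDSMeasure P₀ hP', fun ν hν => ?_⟩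
  have := hν.isProbabilityMeasure
  have hν_nonneg := hψ.ae_nonneg_of_isIDSMeasure (hP'.mono fun x hx => hx.1) hν
  have hP₀_le : P₀ ≤ ENNReal.ofReal ρmax • volume :=
    hρ ▸ RankOneSum.withDensity_ofReal_le_smul hρmax
  have hbound := hψ.withDensity_ofReal_le_smul_volume hP₀_le hP' hν
  have hac : ν.restrict {0}ᶜ ≪ volume :=
    RankOneSum.restrict_compl_zero_absolutelyContinuous hν_nonneg <|
      Measure.absolutelyContinuous_of_le_smul hbound
  refine ⟨hac, RankOneSum.rnDeriv_le_ofReal_div hbound, fun hφ => ?_⟩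
  have hne_zero : ∀ᵐ t ∂ν, t ∈ ({0}ᶜ : Set ℝ) :=
    compl_mem_ae_iff.2 (hψ.measure_singleton_zero_eq_zero ha hP hν hφ)
  rwa [Measure.restrict_eq_self_of_ae_mem hne_zero] at hac
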